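/- Let $B\subset\mathbb R^2$ be a bounded Borel set of positive Lebesgue measure, $b>0$, and $Y=B\times(0,b]\times[0,\pi)$. A point $y=(z,r,\phi)\in Y$ stands for the closed segment in the plane with centre $z$, length $l(y)=r$ and axial orientation $\phi$; we write $y\cap y'$ for the intersection of the corresponding segments. Let $\lambda(d(z,r,\phi))=\rho(z)\,dz\,Q(dr)\,V(d\phi)$, where $\rho\ge 0$ is a bounded measurable function on $B$ and $Q,V$ are probability measures on $(0,b]$ and $[0,\pi)$. Let $\eta$ be the Poisson point process on $Y$ with intensity measure $\lambda$. For a finite point configuration $x$ on $Y$ put $$L(x)=\sum_{s\in x}l(s),\qquad N(x)=\frac12\sum_{(s,t)\in x^2_{\neq}}1_{[s\cap t\neq\emptyset]},$$ where $x^2_{\neq}$ is the set of ordered pairs of different points of $x$. Let $\nu_1\in\mathbb R$ and $\nu_2\le 0$, and let $\mu$ be the point process on $Y$ with density $p(x)=c_\nu^{-1}\exp(\nu_1L(x)+\nu_2N(x))$ with respect to the distribution of $\eta$, where $c_\nu=\mathbb E\exp(\nu_1L(\eta)+\nu_2N(\eta))$. With $D_yF(x)=F(x+\delta_y)-F(x)$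 and $D^2_{y,y'}F=D_y(D_{y'}F)$, define for $y_1,\dots,y_m\in Y$ $$\mathcal E_\mu(y_1,\dots,y_m)=\exp\Big(\sum_{i=1}^m\big(\nu_1D_{y_i}L(\mu)+\nu_2D_{y_i}N(\mu)\big)+\sum_{1\le i<j\le m}\big(\nu_1D^2_{y_i,y_j}L(\mu)+\nu_2D^2_{y_i,y_j}N(\mu)\big)\Big).$$ Then $0<c_\nu<\infty$, so that $p$ is a probability density; all expectations and integrals below are finite; and $$\mathbb E L(\mu)=\int_Y\mathbb E[\mathcal E_\mu(y)]\,l(y)\,\lambda(dy),$$ $$\mathbb E N(\mu)=\frac12\int_{Y^2}\mathbb E[\mathcal E_\mu(y_1,y_2)]\,1_{[y_1\cap y_2\neq\emptyset]}\,\lambda^2(d(y_1,y_2)),$$ $$\mathbb E[L(\mu)^2]=\int_Y\mathbb E[\mathcal E_\mu(y)]\,l(y)^2\,\lambda(dy)+\int_{Y^2}\mathbb E[\mathcal E_\mu(y_1,y_2)]\,l(y_1)l(y_2)\,\lambda^2(d(y_1,y_2)),$$ $$\mathbb E[N(\mu)^2]=\frac12\int_{Y^2}\mathbb E[\mathcal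 E_\mu(y_1,y_2)]\,1_{[y_1\cap y_2\neq\emptyset]}\,\lambda^2(d(y_1,y_2))+\int_{Y^3}\mathbb E[\mathcal E_\mu(y_1,y_2,y_3)]\,1_{[y_1\cap y_2\neq\emptyset]}1_{[y_3\cap y_1\neq\emptyset]}\,\lambda^3(d(y_1,y_2,y_3))$$ $$+\frac14\int_{Y^4}\mathbb E[\mathcal E_\mu(y_1,y_2,y_3,y_4)]\,1_{[y_1\cap y_2\neq\emptyset]}1_{[y_3\cap y_4\neq\emptyset]}\,\lambda^4(d(y_1,\dots,y_4)).$$ -/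

import Mathlib

open MeasureTheory

noncomputable section

namespace SegmentGibbs

/-! ### Finite point configurations

An integer-valued finite measure `∑ δ_{y_i}` on `Y` is represented by the multiset of the `y_i`. -/

section Configurations

variable {Y : Type*}

open Classical in
/-- The number of points, with multiplicity, of the configuration `x` in the set `A`. -/
def count (A : Set Y) (x : Multiset Y) : ℕ := x.countP (· ∈ A)

/-- The smallest σ-algebra that makes all the counting maps `x ↦ x(A)`, `A` measurable,
measurable. -/
instance instMeasurableSpaceConfig [MeasurableSpace Y] : MeasurableSpace (Multiset Y) :=
  ⨆ A : {A : Set Y // MeasurableSet A}, MeasurableSpace.comap (count (A : Set Y)) ⊤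

/-- The configuration `δ_{y_1} + ⋯ + δ_{y_n}`. -/
def ofPoints {n : ℕ} (y : Fin n → Y) : Multiset Y := Finset.univ.val.map y

/-- The distribution of the Poisson point process with finite intensity measure `lam`: the number
of points is Poisson distributed with mean `lam Y` and, given that number, the points are
independent with distribution `lam / lam Y`. In other words
`P(M) = e^{-lam Y} ∑ₙ (1 / n!) lamⁿ {(y_1, …, y_n) : δ_{y_1} + ⋯ + δ_{y_n} ∈ M}`. -/
def poissonLaw [MeasurableSpace Y] (lam : Measure Y) : Measure (Multiset Y) :=
  Measure.sum fun n : ℕ =>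
    ENNReal.ofReal (Real.exp (-(lam Set.univ).toReal) / (n.factorial : ℝ)) •
      (Measure.pi fun _ : Fin n => lam).map ofPoints

/-- The first difference `D_y F (x) = F (x + δ_y) - F (x)`. -/
def diff (y : Y) (F : Multiset Y → ℝ) (x : Multiset Y) : ℝ := F (y ::ₘ x) - F x

/-- The second difference `D²_{y, z} F = D_y (D_z F)`. -/
def diff₂ (y z : Y) (F : Multiset Y → ℝ) : Multiset Y → ℝ := diff y (diff z F)

end Configurations

/-! ### Segments in the plane -/

/-- The Euclidean plane. -/
abbrev Plane := EuclideanSpace ℝ (Fin 2)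

/-- The space `B × (0, b] × [0, π)` of segments `(z, r, φ)` with centre `z`, length `r` and axial
orientation `φ`. -/
abbrev Seg (B : Set Plane) (b : ℝ) := B × Set.Ioc (0 : ℝ) b × Set.Ico (0 : ℝ) Real.pi

/-- The intensity measure `ρ(z) dz Q(dr) V(dφ)`. -/
def intensity {B : Set Plane} {b : ℝ} (ρ : B → NNReal)
    (Q : Measure (Set.Ioc (0 : ℝ) b)) (V : Measure (Set.Ico (0 : ℝ) Real.pi)) :
    Measure (Seg B b) :=
  ((volume.comap (Subtype.val : B → Plane)).withDensity fun z => (ρ z : ENNReal)).prod (Q.prod V)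

variable {B : Set Plane} {b : ℝ}

/-- The length of a segment. -/
def len (y : Seg B b) : ℝ := y.2.1

/-- The closed segment in the plane encoded by `(z, r, φ)`. -/
def carrier (y : Seg B b) : Set Plane :=
  segment ℝ
    ((y.1 : Plane) - (len y / 2) • !₂[Real.cos (y.2.2 : ℝ), Real.sin (y.2.2 : ℝ)])
    ((y.1 : Plane) + (len y / 2) • !₂[Real.cos (y.2.2 : ℝ), Real.sin (y.2.2 : ℝ)])

open Classical in
/-- The indicator of the event that the segments `y` and `z` intersect. -/
def meet (y z : Seg B b) : ℝ := if (carrier y ∩ carrier z).Nonempty then 1 else 0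

/-- The total length `L` of the segments of a configuration. -/
def totalLength (x : Multiset (Seg B b)) : ℝ := (x.map len).sum

open Classical in
/-- The total number `N` of intersections: half the sum, over the ordered pairs of different
segments of the configuration, of the indicator that the two intersect. -/
def numIntersections (x : Multiset (Seg B b)) : ℝ :=
  (1 / 2) * (x.map fun s => (x.map fun t => if s ≠ t then meet s t else 0).sum).sum

/-! ### The Gibbs segment process -/

/-- The unnormalised density `exp (ν₁ L + ν₂ N)`. -/
def weight (ν₁ ν₂ : ℝ) (x : Multiset (Seg B b)) : ℝ :=
  Real.exp (ν₁ * totalLength x + ν₂ * numIntersections x)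

/-- The normalising constant `c_ν = E exp (ν₁ L(η) + ν₂ N(η))`, where `η` is the Poisson process
with intensity measure `lam`. -/
def normConst (lam : Measure (Seg B b)) (ν₁ ν₂ : ℝ) : ℝ :=
  ∫ x, weight ν₁ ν₂ x ∂(poissonLaw lam)

/-- The distribution of the Gibbs segment process `μ`, which has the density
`c_ν⁻¹ exp (ν₁ L + ν₂ N)` with respect to the Poisson process with intensity measure `lam`. -/
def gibbsLaw (lam : Measure (Seg B b)) (ν₁ ν₂ : ℝ) : Measure (Multiset (Seg B b)) :=
  (poissonLaw lam).withDensity fun x =>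
    ENNReal.ofReal ((normConst lam ν₁ ν₂)⁻¹ * weight ν₁ ν₂ x)

/-- `𝓔_x(y_1, …, y_m) = exp (∑_i ν · D_{y_i} G (x) + ∑_{i < j} ν · D²_{y_i, y_j} G (x))`, where
`G = (L, N)`. -/
def expDiff (ν₁ ν₂ : ℝ) {m : ℕ} (y : Fin m → Seg B b) (x : Multiset (Seg B b)) : ℝ :=
  Real.exp
    ((∑ i, (ν₁ * diff (y i) totalLength x + ν₂ * diff (y i) numIntersections x)) +
      ∑ i, ∑ j ∈ Finset.Ioi i,
        (ν₁ * diff₂ (y i) (y j) totalLength x + ν₂ * diff₂ (y i) (y j) numIntersections x))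

/-- The expectation `E[𝓔_μ(y_1, …, y_m)]`, where `μ` is the Gibbs segment process. -/
def meanExpDiff (lam : Measure (Seg B b)) (ν₁ ν₂ : ℝ) {m : ℕ} (y : Fin m → Seg B b) : ℝ :=
  ∫ x, expDiff ν₁ ν₂ y x ∂(gibbsLaw lam ν₁ ν₂)

end SegmentGibbs

end

open SegmentGibbs

open SegmentGibbs

/-! The moments are computed in `ℝ≥0∞` by integrating `F * density` against the Poisson law, for `F`
equal to `L`, `N`, `L²`, `N²`, and removing the points over which `F` sums one by one with the Mecke
equation `lintegral_sum_poissonLaw`. Each removed point becomes an integration variable for the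
intensity and is added to the argument of the density. What remains is the expectation of the
density at `y_1, …, y_m` plus a Poisson configuration, called `correlation`.

This expectation equals `E[𝓔_μ(y_1, …, y_m)]` (`correlation_density`). Indeed `L` is linear and `N`
quadratic in the configuration, so first and second differences determine how `ν₁ L + ν₂ N` changes
when the `y_i` are added, and the weight gets multiplied exactly by `𝓔_x(y_1, …, y_m)`
(`weight_ofPoints_add`).

For the squares, a point removed for one factor also enters the other factor. The coincidences give
the lower-order integrals: one shared point for `L²`; two shared segments, one shared segment or
none for `N²` (`lintegral_map_sum_sq_mul`, `lintegral_pairSum_sq_mul`).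

Finiteness rests on three facts: the intensity is finite, lengths are at most `b`, and `ν₂ ≤ 0`
makes intersections only lower the weight. Since `N` ignores pairs of equal segments while the
integrals do not, the intensity must also have no atoms. -/

section

open ProbabilityTheory Function
open scoped ENNReal

namespace SegmentGibbs

/-! ### Counting points and adding points to configurations. -/

section Points

variable {Y : Type*}

theorem count_add (A : Set Y) (x x' : Multiset Y) : count A (x + x') = count A x + count A x' := by
  classical
  simp [count]

theorem count_singleton (A : Set Y) (s : Y) : count A {s} = A.indicator 1 s := by
  classical
  rw [count, ← Multiset.cons_zero, Multiset.countP_cons]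
  simp [Set.indicator_apply]

theorem ofPoints_zero (y : Fin 0 → Y) : ofPoints y = 0 := by
  simp [ofPoints]

theorem ofPoints_insertNth {n : ℕ} (i : Fin (n + 1)) (s : Y) (y : Fin n → Y) :
    ofPoints (i.insertNth s y : Fin (n + 1) → Y) = s ::ₘ ofPoints y := by
  rw [ofPoints, Fin.univ_succAbove n i]
  simp [ofPoints]

theorem ofPoints_cons {n : ℕ} (s : Y) (y : Fin n → Y) :
    ofPoints (Fin.cons s y : Fin (n + 1) → Y) = s ::ₘ ofPoints y := by
  rw [← Fin.insertNth_zero']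
  exact ofPoints_insertNth 0 s y

end Points

/-! ### Measurability on the space of configurations. -/

section Measurability

variable {Y : Type*} [MeasurableSpace Y]

theorem measurable_count {A : Set Y} (hA : MeasurableSet A) :
    Measurable (count A : Multiset Y → ℕ) :=
  Measurable.mono (comap_measurable _)
    (le_iSup (fun A : {A : Set Y // MeasurableSet A} =>
      MeasurableSpace.comap (count (A : Set Y)) ⊤) ⟨A, hA⟩) le_rfl

theorem measurable_config {α : Type*} [MeasurableSpace α] {f : α → Multiset Y}
    (hf : ∀ A, MeasurableSet A → Measurable fun a => count A (f a)) : Measurable f := by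
  rw [measurable_iff_comap_le, instMeasurableSpaceConfig, MeasurableSpace.comap_iSup]
  refine iSup_le fun A => ?_
  rw [MeasurableSpace.comap_comp, ← measurable_iff_comap_le]
  exact hf A A.2

theorem measurable_config_singleton : Measurable fun s : Y => ({s} : Multiset Y) := by
  refine measurable_config fun A hA => ?_
  simp_rw [count_singleton]
  exact (measurable_const (a := (1 : ℕ))).indicator hA

theorem measurable_config_add {α : Type*} [MeasurableSpace α] {f g : α → Multiset Y}
    (hf : Measurable f) (hg : Measurable g) : Measurable fun a => f a + g a := by
  refine measurable_config fun A hA => ?_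
  simp_rw [count_add]
  exact ((measurable_count hA).comp hf).add ((measurable_count hA).comp hg)

theorem measurable_config_cons {α : Type*} [MeasurableSpace α] {f : α → Y} {g : α → Multiset Y}
    (hf : Measurable f) (hg : Measurable g) : Measurable fun a => f a ::ₘ g a := by
  simp_rw [← Multiset.singleton_add]
  exact measurable_config_add (measurable_config_singleton.comp hf) hg

theorem measurable_ofPoints : ∀ n : ℕ, Measurable (ofPoints : (Fin n → Y) → Multiset Y)
  | 0 => by
    have : (ofPoints : (Fin 0 → Y) → Multiset Y) = fun _ => 0 := funext ofPoints_zero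
    rw [this]
    exact measurable_const
  | n + 1 => by
    have : (ofPoints : (Fin (n + 1) → Y) → Multiset Y) =
        fun y => y 0 ::ₘ ofPoints (fun i => y i.succ) := by
      funext y
      conv_lhs => rw [← Fin.cons_self_tail y]
      exact ofPoints_cons _ _
    rw [this]
    refine measurable_config_cons (measurable_pi_apply 0) ((measurable_ofPoints n).comp ?_)
    fun_prop

/-- The integer-valued measure `∑ δ_s` represented by a configuration. -/
noncomputable def toMeasure (x : Multiset Y) : Measure Y := (x.map Measure.dirac).sum

theorem toMeasure_cons (s : Y) (x : Multiset Y) :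
    toMeasure (s ::ₘ x) = Measure.dirac s + toMeasure x := by
  simp [toMeasure]

theorem toMeasure_apply (x : Multiset Y) {A : Set Y} (hA : MeasurableSet A) :
    toMeasure x A = count A x := by
  induction x using Multiset.induction_on with
  | empty => simp [toMeasure, count]
  | cons s x ih =>
    rw [toMeasure_cons, Measure.add_apply, ih, Measure.dirac_apply' _ hA, ← Multiset.singleton_add,
      count_add, count_singleton]
    by_cases h : s ∈ A <;> simp [h]

theorem lintegral_toMeasure (x : Multiset Y) {f : Y → ℝ≥0∞} (hf : Measurable f) :
    ∫⁻ s, f s ∂toMeasure x = (x.map f).sum := by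
  induction x using Multiset.induction_on with
  | empty => simp [toMeasure]
  | cons s x ih => rw [toMeasure_cons, lintegral_add_measure, ih, lintegral_dirac' _ hf]; simp

theorem measurable_toMeasure : Measurable (toMeasure : Multiset Y → Measure Y) := by
  refine Measure.measurable_of_measurable_coe _ fun A hA => ?_
  simp_rw [toMeasure_apply _ hA]
  exact (measurable_of_countable (fun n : ℕ => (n : ℝ≥0∞))).comp (measurable_count hA)

/-- The kernel that maps a configuration to the measure it represents. -/
noncomputable def configKernel (Y : Type*) [MeasurableSpace Y] : Kernel (Multiset Y) Y :=
  ⟨toMeasure, measurable_toMeasure⟩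

/-- Cutting the configuration space according to the number of points writes the kernel as a
countable sum of kernels of mass at most `n`. -/
instance : IsSFiniteKernel (configKernel Y) := by
  classical
  have hs (n : ℕ) : MeasurableSet {x : Multiset Y | count Set.univ x = n} :=
    measurable_count MeasurableSet.univ (measurableSet_singleton n)
  have : configKernel Y = Kernel.sum fun n => Kernel.piecewise (hs n) (configKernel Y) 0 := by
    ext x A hA
    rw [Kernel.sum_apply' _ _ hA, tsum_eq_single (count Set.univ x)]
    · simp [Kernel.piecewise_apply]
    · intro n hn
      have : x ∉ {x : Multiset Y | count Set.univ x = n} := fun h => hn h.symm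
      simp [Kernel.piecewise_apply, Ne.symm hn]
  rw [this]
  have (n : ℕ) : IsFiniteKernel (Kernel.piecewise (hs n) (configKernel Y) 0) := by
    refine ⟨n, ENNReal.natCast_lt_top n, fun x => ?_⟩
    rw [Kernel.piecewise_apply]
    split_ifs with h
    · change toMeasure x _ ≤ _
      rw [toMeasure_apply _ MeasurableSet.univ]
      exact_mod_cast h.le
    · simp
  infer_instance

/-- The sum is an integral against the s-finite kernel `configKernel`, so joint measurability is
that of a parametrised integral. -/
theorem measurable_config_sum {α : Type*} [MeasurableSpace α] {f : α → Y → ℝ≥0∞}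
    {x : α → Multiset Y} (hf : Measurable (uncurry f)) (hx : Measurable x) :
    Measurable fun a => ((x a).map (f a)).sum := by
  have h : Measurable fun a => ∫⁻ s, f a s ∂((configKernel Y).comap x hx a) :=
    hf.lintegral_kernel_prod_right
  convert h using 2 with a
  exact (lintegral_toMeasure _ (hf.comp measurable_prodMk_left)).symm

end Measurability

/-! ### The Poisson law: exponential moments of the number of points and the Mecke equation. -/

section Poisson

variable {Y : Type*} [MeasurableSpace Y] (lam : Measure Y)

theorem lintegral_pi_succAbove [SigmaFinite lam] {n : ℕ} (i : Fin (n + 1))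
    {F : (Fin (n + 1) → Y) → ℝ≥0∞} (hF : Measurable F) :
    ∫⁻ y, F y ∂(Measure.pi fun _ => lam) =
      ∫⁻ s, ∫⁻ y, F (i.insertNth s y) ∂(Measure.pi fun _ => lam) ∂lam := by
  have h := (measurePreserving_piFinSuccAbove (fun _ : Fin (n + 1) => lam) i).symm
  rw [← h.lintegral_comp hF]
  exact lintegral_prod _ (hF.comp h.measurable).aemeasurable

theorem lintegral_pi_cons [SigmaFinite lam] {n : ℕ}
    {F : (Fin (n + 1) → Y) → ℝ≥0∞} (hF : Measurable F) :
    ∫⁻ y, F y ∂(Measure.pi fun _ => lam) =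
      ∫⁻ s, ∫⁻ y, F (Fin.cons s y) ∂(Measure.pi fun _ => lam) ∂lam := by
  rw [lintegral_pi_succAbove lam 0 hF]
  simp_rw [Fin.insertNth_zero']

theorem lintegral_pi_fin_zero (F : (Fin 0 → Y) → ℝ≥0∞) :
    ∫⁻ y, F y ∂(Measure.pi fun _ => lam) = F ![] := by
  rw [Measure.pi_of_empty, lintegral_dirac]
  congr 1

/-- The probability of `n` points, divided by the mass of `lam ^ n`. -/
noncomputable def poissonCoeff (lam : Measure Y) (n : ℕ) : ℝ≥0∞ :=
  ENNReal.ofReal (Real.exp (-(lam Set.univ).toReal) / (n.factorial : ℝ))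

theorem poissonCoeff_succ (n : ℕ) :
    poissonCoeff lam (n + 1) * (n + 1 : ℕ) = poissonCoeff lam n := by
  rw [poissonCoeff, poissonCoeff, ← ENNReal.ofReal_natCast, ← ENNReal.ofReal_mul (by positivity)]
  congr 1
  rw [Nat.factorial_succ]
  push_cast
  field_simp

theorem lintegral_poissonLaw {F : Multiset Y → ℝ≥0∞} (hF : Measurable F) :
    ∫⁻ x, F x ∂(poissonLaw lam) =
      ∑' n, poissonCoeff lam n * ∫⁻ y : Fin n → Y, F (ofPoints y) ∂(Measure.pi fun _ => lam) := by
  rw [poissonLaw, lintegral_sum_measure]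
  congr 1 with n
  rw [lintegral_smul_measure, lintegral_map hF (measurable_ofPoints n)]
  rfl

theorem poissonLaw_univ_pos : poissonLaw lam Set.univ ≠ 0 := by
  rw [← lintegral_one, lintegral_poissonLaw lam measurable_const]
  intro h
  have := ENNReal.tsum_eq_zero.1 h 0
  rw [lintegral_pi_fin_zero, mul_one, poissonCoeff, ENNReal.ofReal_eq_zero] at this
  exact absurd this (not_le.2 (by positivity))

/-- The generating function of the number of points is finite. -/
theorem lintegral_pow_card_poissonLaw_lt_top [IsFiniteMeasure lam] {a : ℝ} (ha : 0 ≤ a) :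
    ∫⁻ x, ENNReal.ofReal (a ^ count Set.univ x) ∂(poissonLaw lam) < ∞ := by
  have hm : Measurable fun x : Multiset Y => ENNReal.ofReal (a ^ count Set.univ x) :=
    (measurable_of_countable fun n : ℕ => ENNReal.ofReal (a ^ n)).comp
      (measurable_count MeasurableSet.univ)
  rw [lintegral_poissonLaw lam hm]
  have h (n : ℕ) : poissonCoeff lam n * ∫⁻ y : Fin n → Y,
      ENNReal.ofReal (a ^ count Set.univ (ofPoints y)) ∂(Measure.pi fun _ => lam) =
      ENNReal.ofReal (Real.exp (-(lam Set.univ).toReal) *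
        ((a * (lam Set.univ).toReal) ^ n / n.factorial)) := by
    have hc (y : Fin n → Y) : count Set.univ (ofPoints y) = n := by simp [count, ofPoints]
    simp_rw [hc, lintegral_const, Measure.pi_univ, Finset.prod_const, Finset.card_univ,
      Fintype.card_fin]
    rw [poissonCoeff, ← ENNReal.ofReal_toReal (measure_ne_top lam Set.univ),
      ← ENNReal.ofReal_pow ENNReal.toReal_nonneg, ← ENNReal.ofReal_mul (by positivity),
      ← ENNReal.ofReal_mul (by positivity), ENNReal.toReal_ofReal ENNReal.toReal_nonneg]
    congr 1
    ring
  simp_rw [h]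
  rw [← ENNReal.ofReal_tsum_of_nonneg (fun n => by positivity)
    ((Real.summable_pow_div_factorial _).mul_left _)]
  exact ENNReal.ofReal_lt_top

instance [IsFiniteMeasure lam] : IsFiniteMeasure (poissonLaw lam) := by
  constructor
  simpa using lintegral_pow_card_poissonLaw_lt_top lam zero_le_one

/-- The Mecke equation. -/
theorem lintegral_sum_poissonLaw [IsFiniteMeasure lam] {f : Y → Multiset Y → ℝ≥0∞}
    (hf : Measurable (uncurry f)) :
    ∫⁻ x, (x.map fun s => f s x).sum ∂(poissonLaw lam) =
      ∫⁻ s, ∫⁻ x, f s (s ::ₘ x) ∂(poissonLaw lam) ∂lam := by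
  have hS : Measurable fun x : Multiset Y => (x.map fun s => f s x).sum :=
    measurable_config_sum (f := fun x s => f s x) (hf.comp measurable_swap) measurable_id
  have hC : Measurable fun p : Y × Multiset Y => f p.1 (p.1 ::ₘ p.2) :=
    hf.comp (measurable_fst.prodMk (measurable_config_cons measurable_fst measurable_snd))
  have hC' (s : Y) : Measurable fun x : Multiset Y => f s (s ::ₘ x) :=
    hC.comp measurable_prodMk_left
  have hCn (n : ℕ) : Measurable fun p : Y × (Fin n → Y) => f p.1 (p.1 ::ₘ ofPoints p.2) :=
    hC.comp (measurable_fst.prodMk ((measurable_ofPoints n).comp measurable_snd))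
  rw [lintegral_poissonLaw lam hS]
  simp_rw [fun s => lintegral_poissonLaw lam (hC' s)]
  -- The sum over the empty configuration vanishes, so the term for `n + 1` points on the left is
  -- matched with the term for `n` points on the right.
  rw [lintegral_tsum fun n => ((hCn n).lintegral_prod_right'.const_mul _).aemeasurable,
    tsum_eq_zero_add' ENNReal.summable]
  simp only [ofPoints_zero, Multiset.map_zero, Multiset.sum_zero, lintegral_zero, mul_zero,
    zero_add]
  congr 1 with n
  rw [lintegral_const_mul _ (hCn n).lintegral_prod_right', ← poissonCoeff_succ lam n, mul_assoc]
  congr 1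
  have hi (i : Fin (n + 1)) :
      Measurable fun y : Fin (n + 1) → Y => f (y i) (ofPoints y) :=
    hf.comp ((measurable_pi_apply i).prodMk (measurable_ofPoints _))
  have hsum (y : Fin (n + 1) → Y) : ((ofPoints y).map fun s => f s (ofPoints y)).sum =
      ∑ i, f (y i) (ofPoints y) := by
    conv_lhs => enter [1, 2]; rw [ofPoints]
    rw [Multiset.map_map]
    rfl
  simp_rw [hsum]
  rw [lintegral_finsetSum _ fun i _ => hi i]
  -- Integrate out the `i`-th point separately. `ofPoints` forgets the order, so the `n + 1`
  -- summands agree and supply the factor `n + 1` split off by `poissonCoeff_succ`.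
  simp_rw [fun i => lintegral_pi_succAbove lam i (hi i), ofPoints_insertNth,
    Fin.insertNth_apply_same]
  simp

end Poisson

/-! ### Integrals over powers of the intensity as iterated integrals. -/

section IteratedPi

variable {Y : Type*} [MeasurableSpace Y] (lam : Measure Y) [SigmaFinite lam]

theorem measurable_fin_cons {n : ℕ} (s : Y) :
    Measurable fun y : Fin n → Y => (Fin.cons s y : Fin (n + 1) → Y) :=
  measurable_pi_iff.2 fun i => by
    refine Fin.cases ?_ (fun j => ?_) i
    · simp
    · simpa using measurable_pi_apply j

theorem lintegral_pi_fin_one {F : (Fin 1 → Y) → ℝ≥0∞} (hF : Measurable F) :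
    ∫⁻ y, F y ∂(Measure.pi fun _ => lam) = ∫⁻ s, F ![s] ∂lam := by
  rw [lintegral_pi_cons lam hF]
  simp_rw [lintegral_pi_fin_zero]
  rfl

theorem lintegral_pi_fin_two {F : (Fin 2 → Y) → ℝ≥0∞} (hF : Measurable F) :
    ∫⁻ y, F y ∂(Measure.pi fun _ => lam) = ∫⁻ s, ∫⁻ t, F ![s, t] ∂lam ∂lam := by
  rw [lintegral_pi_cons lam hF]
  simp_rw [fun s => lintegral_pi_fin_one lam (F := fun y => F (Fin.cons s y))
    (hF.comp (measurable_fin_cons s))]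
  rfl

theorem lintegral_pi_fin_three {F : (Fin 3 → Y) → ℝ≥0∞} (hF : Measurable F) :
    ∫⁻ y, F y ∂(Measure.pi fun _ => lam) =
      ∫⁻ s, ∫⁻ t, ∫⁻ u, F ![s, t, u] ∂lam ∂lam ∂lam := by
  rw [lintegral_pi_cons lam hF]
  simp_rw [fun s => lintegral_pi_fin_two lam (F := fun y => F (Fin.cons s y))
    (hF.comp (measurable_fin_cons s))]
  rfl

theorem lintegral_pi_fin_four {F : (Fin 4 → Y) → ℝ≥0∞} (hF : Measurable F) :
    ∫⁻ y, F y ∂(Measure.pi fun _ => lam) =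
      ∫⁻ s, ∫⁻ t, ∫⁻ u, ∫⁻ v, F ![s, t, u, v] ∂lam ∂lam ∂lam ∂lam := by
  rw [lintegral_pi_cons lam hF]
  simp_rw [fun s => lintegral_pi_fin_three lam (F := fun y => F (Fin.cons s y))
    (hF.comp (measurable_fin_cons s))]
  rfl

end IteratedPi

/-! ### First and second moments of sums over points and over pairs. -/

section Moments

theorem lintegral_two_mul_add_add_add {α : Type*} [MeasurableSpace α] (P : Measure α)
    {a b c : α → ℝ≥0∞} (ha : Measurable a) (hb : Measurable b) (hc : Measurable c)
    (d : α → ℝ≥0∞) :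
    ∫⁻ x, (2 * a x + 2 * b x + 2 * c x + d x) ∂P =
      2 * ∫⁻ x, a x ∂P + 2 * ∫⁻ x, b x ∂P + 2 * ∫⁻ x, c x ∂P + ∫⁻ x, d x ∂P := by
  rw [lintegral_add_left (by fun_prop), lintegral_add_left (by fun_prop),
    lintegral_add_left (by fun_prop), lintegral_const_mul _ ha, lintegral_const_mul _ hb,
    lintegral_const_mul _ hc]

variable {Y : Type*} [MeasurableSpace Y] (lam : Measure Y)

/-- The sum of `g` over the pairs of points of a configuration. -/
noncomputable def pairSum (g : Y → Y → ℝ≥0∞) (x : Multiset Y) : ℝ≥0∞ :=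
  (x.map fun s => (x.map (g s)).sum).sum

/-- The expectation of `W (X + η)` for a Poisson process `η`; if `W` is the density of a process
with respect to `η`, this is its correlation function. -/
noncomputable def correlation (W : Multiset Y → ℝ≥0∞) (X : Multiset Y) : ℝ≥0∞ :=
  ∫⁻ x, W (X + x) ∂(poissonLaw lam)

omit [MeasurableSpace Y] in
-- The new point occurs as first and as second entry of a pair, equally by symmetry, and its pair
-- with itself contributes nothing.
theorem pairSum_cons {g : Y → Y → ℝ≥0∞} (hsymm : ∀ s t, g s t = g t s) (hdiag : ∀ s, g s s = 0)
    (s : Y) (x : Multiset Y) :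
    pairSum g (s ::ₘ x) = 2 * (x.map (g s)).sum + pairSum g x := by
  simp only [pairSum, Multiset.map_cons, Multiset.sum_cons, hdiag, zero_add,
    Multiset.sum_map_add]
  simp_rw [fun t => hsymm t s]
  ring

theorem measurable_pairSum {g : Y → Y → ℝ≥0∞} (hg : Measurable (uncurry g)) :
    Measurable (pairSum g) :=
  measurable_config_sum (f := fun x s => (x.map (g s)).sum)
    (measurable_config_sum (f := fun p : Multiset Y × Y => g p.2)
      (hg.comp ((measurable_snd.comp measurable_fst).prodMk measurable_snd)) measurable_fst)
    measurable_id

variable {W : Multiset Y → ℝ≥0∞}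

theorem measurable_correlation [IsFiniteMeasure lam] (hW : Measurable W) :
    Measurable (correlation lam W) := by
  have h : Measurable fun p : Multiset Y × Multiset Y => W (p.1 + p.2) :=
    hW.comp (measurable_config_add measurable_fst measurable_snd)
  exact h.lintegral_prod_right'

theorem measurable_map_sum {f : Y → ℝ≥0∞} (hf : Measurable f) :
    Measurable fun x : Multiset Y => (x.map f).sum :=
  measurable_config_sum (f := fun _ => f) (hf.comp measurable_snd) measurable_id

variable [IsFiniteMeasure lam]

theorem lintegral_map_sum_mul {f : Y → ℝ≥0∞} (hf : Measurable f) {K : Multiset Y → ℝ≥0∞}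
    (hK : Measurable K) :
    ∫⁻ x, (x.map f).sum * K x ∂(poissonLaw lam) =
      ∫⁻ s, f s * ∫⁻ x, K (s ::ₘ x) ∂(poissonLaw lam) ∂lam := by
  simp_rw [← Multiset.sum_map_mul_right]
  rw [lintegral_sum_poissonLaw lam (f := fun s x => f s * K x)
    ((hf.comp measurable_fst).mul (hK.comp measurable_snd))]
  congr 1 with s
  exact lintegral_const_mul _ (hK.comp (measurable_config_cons measurable_const measurable_id))

/-- The Mecke equation twice. After the first use the inner sum runs over `s ::ₘ x`, and `hdiag`
discards its term at `s`. -/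
theorem lintegral_pairSum_mul {g : Y → Y → ℝ≥0∞} (hg : Measurable (uncurry g))
    (hdiag : ∀ s, g s s = 0) {K : Multiset Y → ℝ≥0∞} (hK : Measurable K) :
    ∫⁻ x, pairSum g x * K x ∂(poissonLaw lam) =
      ∫⁻ s, ∫⁻ t, g s t * ∫⁻ x, K (s ::ₘ t ::ₘ x) ∂(poissonLaw lam) ∂lam ∂lam := by
  have hgs : Measurable fun p : Y × Multiset Y => (p.2.map (g p.1)).sum :=
    measurable_config_sum (f := fun p : Y × Multiset Y => g p.1)
      (hg.comp ((measurable_fst.comp measurable_fst).prodMk measurable_snd)) measurable_snd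
  have e (x : Multiset Y) : pairSum g x * K x = (x.map fun s => (x.map (g s)).sum * K x).sum := by
    rw [Multiset.sum_map_mul_right]
    rfl
  simp_rw [e]
  rw [lintegral_sum_poissonLaw lam (f := fun s x => (x.map (g s)).sum * K x)
    (hgs.mul (hK.comp measurable_snd))]
  simp only [Multiset.map_cons, Multiset.sum_cons, hdiag, zero_add]
  congr 1 with s
  exact lintegral_map_sum_mul lam (hg.comp measurable_prodMk_left)
    (K := fun x => K (s ::ₘ x)) (hK.comp (measurable_config_cons measurable_const measurable_id))

/-- Here `X` collects the points that have already been removed from the configuration. -/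
theorem lintegral_map_sum_mul_correlation {f : Y → ℝ≥0∞} (hf : Measurable f) (hW : Measurable W)
    (X : Multiset Y) :
    ∫⁻ x, (x.map f).sum * W (X + x) ∂(poissonLaw lam) =
      ∫⁻ u, f u * correlation lam W (u ::ₘ X) ∂lam := by
  rw [lintegral_map_sum_mul lam hf (K := fun x => W (X + x))
    (hW.comp (measurable_config_add measurable_const measurable_id))]
  simp [correlation]

theorem lintegral_pairSum_mul_correlation {g : Y → Y → ℝ≥0∞} (hg : Measurable (uncurry g))
    (hdiag : ∀ s, g s s = 0) (hW : Measurable W) (X : Multiset Y) :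
    ∫⁻ x, pairSum g x * W (X + x) ∂(poissonLaw lam) =
      ∫⁻ u, ∫⁻ v, g u v * correlation lam W (u ::ₘ v ::ₘ X) ∂lam ∂lam := by
  rw [lintegral_pairSum_mul lam hg hdiag (K := fun x => W (X + x))
    (hW.comp (measurable_config_add measurable_const measurable_id))]
  simp [correlation]

/-- Removing `s` for one factor turns the other into `f s` plus the sum over the remaining points:
the diagonal and the off-diagonal term. -/
theorem lintegral_map_sum_sq_mul {f : Y → ℝ≥0∞} (hf : Measurable f) (hW : Measurable W) :
    ∫⁻ x, (x.map f).sum ^ 2 * W x ∂(poissonLaw lam) =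
      ∫⁻ s, f s ^ 2 * correlation lam W {s} ∂lam +
        ∫⁻ s, f s * ∫⁻ t, f t * correlation lam W {s, t} ∂lam ∂lam := by
  have hw := measurable_correlation lam hW
  have hW' (s : Y) : Measurable fun x => W (s ::ₘ x) :=
    hW.comp (measurable_config_cons measurable_const measurable_id)
  simp_rw [sq, mul_assoc]
  rw [lintegral_map_sum_mul lam hf (K := fun x => (x.map f).sum * W x)
    ((measurable_map_sum hf).mul hW),
    ← lintegral_add_left (f := fun s => f s * (f s * correlation lam W {s}))
      (hf.mul (hf.mul (hw.comp measurable_config_singleton)))]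
  congr 1 with s
  simp only [Multiset.map_cons, Multiset.sum_cons, add_mul]
  rw [lintegral_add_left ((hW' s).const_mul _), lintegral_const_mul _ (hW' s), mul_add]
  congr 2
  have h := lintegral_map_sum_mul_correlation lam hf hW {s}
  simp only [Multiset.singleton_add] at h
  rw [h]
  congr 1 with t
  rw [Multiset.pair_comm]
  rfl

/-- Removing a pair `s, t` for one factor leaves `pairSum g (s ::ₘ t ::ₘ x)` for the other. It
splits into `2 g s t`, twice the sums of `g s` and of `g t` over `x`, and `pairSum g x`, that is,
into pairs sharing two, one or no points with the removed pair. Symmetry in `s` and `t` merges the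
two middle terms, whence the coefficients 2, 4, 1. -/
theorem lintegral_pairSum_sq_mul {g : Y → Y → ℝ≥0∞} (hg : Measurable (uncurry g))
    (hsymm : ∀ s t, g s t = g t s) (hdiag : ∀ s, g s s = 0) (hidem : ∀ s t, g s t * g s t = g s t)
    (hW : Measurable W) :
    ∫⁻ x, pairSum g x ^ 2 * W x ∂(poissonLaw lam) =
      2 * ∫⁻ s, ∫⁻ t, g s t * correlation lam W {s, t} ∂lam ∂lam +
      4 * ∫⁻ s, ∫⁻ t, g s t * ∫⁻ u, g s u * correlation lam W {s, t, u} ∂lam ∂lam ∂lam +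
      ∫⁻ s, ∫⁻ t, g s t *
        ∫⁻ u, ∫⁻ v, g u v * correlation lam W {s, t, u, v} ∂lam ∂lam ∂lam ∂lam := by
  have hw := measurable_correlation lam hW
  have hg' {α : Type _} [MeasurableSpace α] {a c : α → Y} (ha : Measurable a)
      (hc : Measurable c) : Measurable fun x => g (a x) (c x) := hg.comp (ha.prodMk hc)
  have hc2 {α : Type _} [MeasurableSpace α] {a c : α → Y} (ha : Measurable a)
      (hc : Measurable c) : Measurable fun x => ({a x, c x} : Multiset Y) :=
    measurable_config_cons ha (measurable_config_singleton.comp hc)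
  -- `I₃` belongs to a second pair through the first coordinate of `p`, `I₄` to a second pair
  -- disjoint from the first.
  set I₃ : Y × Y → ℝ≥0∞ := fun p => ∫⁻ u, g p.1 u * correlation lam W {p.1, p.2, u} ∂lam with hI₃
  set I₄ : Y × Y → ℝ≥0∞ :=
    fun p => ∫⁻ u, ∫⁻ v, g u v * correlation lam W {p.1, p.2, u, v} ∂lam ∂lam with hI₄
  have mI₃ : Measurable I₃ := by
    have : Measurable fun q : (Y × Y) × Y =>
        g q.1.1 q.2 * correlation lam W {q.1.1, q.1.2, q.2} :=
      (hg' (by fun_prop) (by fun_prop)).mul (hw.comp (measurable_config_cons (by fun_prop)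
        (hc2 (by fun_prop) (by fun_prop))))
    exact this.lintegral_prod_right'
  have mI₄ : Measurable I₄ := by
    have : Measurable fun q : ((Y × Y) × Y) × Y =>
        g q.1.2 q.2 * correlation lam W {q.1.1.1, q.1.1.2, q.1.2, q.2} :=
      (hg' (by fun_prop) (by fun_prop)).mul (hw.comp (measurable_config_cons (by fun_prop)
        (measurable_config_cons (by fun_prop) (hc2 (by fun_prop) (by fun_prop)))))
    exact this.lintegral_prod_right'.lintegral_prod_right'
  have key (s t : Y) : ∫⁻ x, pairSum g (s ::ₘ t ::ₘ x) * W (s ::ₘ t ::ₘ x) ∂(poissonLaw lam) =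
      2 * (g s t * correlation lam W {s, t}) + 2 * I₃ (s, t) + 2 * I₃ (t, s) + I₄ (s, t) := by
    have hW' : Measurable fun x => W ({s, t} + x) :=
      hW.comp (measurable_config_add measurable_const measurable_id)
    have mG (a : Y) : Measurable fun x : Multiset Y => (x.map (g a)).sum :=
      measurable_map_sum (hg' measurable_const measurable_id)
    have e (x : Multiset Y) : pairSum g (s ::ₘ t ::ₘ x) * W (s ::ₘ t ::ₘ x) =
        2 * (g s t * W ({s, t} + x)) + 2 * ((x.map (g s)).sum * W ({s, t} + x)) +
          2 * ((x.map (g t)).sum * W ({s, t} + x)) + pairSum g x * W ({s, t} + x) := by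
      have : s ::ₘ t ::ₘ x = {s, t} + x := by
        simp [Multiset.insert_eq_cons, Multiset.singleton_add]
      rw [← this, pairSum_cons hsymm hdiag, pairSum_cons hsymm hdiag, Multiset.map_cons,
        Multiset.sum_cons]
      ring
    simp_rw [e]
    have mGW (a : Y) : Measurable fun x : Multiset Y => (x.map (g a)).sum * W ({s, t} + x) :=
      (mG a).mul hW'
    rw [lintegral_two_mul_add_add_add _ (hW'.const_mul _) (mGW s) (mGW t),
      lintegral_const_mul _ hW',
      lintegral_map_sum_mul_correlation lam (f := g s) (hg' measurable_const measurable_id) hW,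
      lintegral_map_sum_mul_correlation lam (f := g t) (hg' measurable_const measurable_id) hW,
      lintegral_pairSum_mul_correlation lam hg hdiag hW]
    have e3 (u : Y) : u ::ₘ ({s, t} : Multiset Y) = {s, t, u} := by
      simp only [Multiset.insert_eq_cons, ← Multiset.cons_zero]
      rw [Multiset.cons_swap u, Multiset.cons_swap u]
    have e3' (u : Y) : ({s, t, u} : Multiset Y) = {t, s, u} := Multiset.cons_swap _ _ _
    have e4 (u v : Y) : u ::ₘ v ::ₘ ({s, t} : Multiset Y) = {s, t, u, v} := by
      simp only [Multiset.insert_eq_cons, ← Multiset.cons_zero]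
      rw [Multiset.cons_swap v, Multiset.cons_swap v, Multiset.cons_swap u, Multiset.cons_swap u]
    simp_rw [hI₃, hI₄, e4, e3, e3']
    rfl
  simp_rw [sq, mul_assoc]
  rw [lintegral_pairSum_mul lam hg hdiag (K := fun x => pairSum g x * W x)
    ((measurable_pairSum hg).mul hW)]
  simp_rw [key]
  have m2 : Measurable fun p : Y × Y => g p.1 p.2 * correlation lam W {p.1, p.2} :=
    hg.mul (hw.comp (hc2 measurable_fst measurable_snd))
  have m3 : Measurable fun p : Y × Y => g p.1 p.2 * I₃ (p.1, p.2) := hg.mul mI₃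
  have m3' : Measurable fun p : Y × Y => g p.1 p.2 * I₃ (p.2, p.1) :=
    hg.mul (mI₃.comp measurable_swap)
  have m4 : Measurable fun p : Y × Y => g p.1 p.2 * I₄ (p.1, p.2) := hg.mul mI₄
  have hswap : ∫⁻ s, ∫⁻ t, g s t * I₃ (t, s) ∂lam ∂lam =
      ∫⁻ s, ∫⁻ t, g s t * I₃ (s, t) ∂lam ∂lam := by
    rw [lintegral_lintegral_swap m3'.aemeasurable]
    simp_rw [fun s t => hsymm t s]
  have e (s t : Y) : g s t * (2 * (g s t * correlation lam W {s, t}) + 2 * I₃ (s, t) +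
      2 * I₃ (t, s) + I₄ (s, t)) = 2 * (g s t * correlation lam W {s, t}) +
        2 * (g s t * I₃ (s, t)) + 2 * (g s t * I₃ (t, s)) + g s t * I₄ (s, t) := by
    -- Idempotence is needed in the first summand only. The rewriting hits all four summands, so it
    -- is undone in the other three.
    conv_rhs => rw [← hidem s t]
    conv_rhs => enter [1, 1, 2]; rw [hidem s t]
    conv_rhs => enter [1, 2]; rw [hidem s t]
    conv_rhs => enter [2]; rw [hidem s t]
    ring
  simp_rw [e]
  -- Over the product measure the four summands are separated in a single step.
  have hp (F : Y × Y → ℝ≥0∞) (hF : Measurable F) :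
      ∫⁻ s, ∫⁻ t, F (s, t) ∂lam ∂lam = ∫⁻ p, F p ∂(lam.prod lam) :=
    (lintegral_prod _ hF.aemeasurable).symm
  rw [hp (fun p => 2 * (g p.1 p.2 * correlation lam W {p.1, p.2}) +
        2 * (g p.1 p.2 * I₃ (p.1, p.2)) + 2 * (g p.1 p.2 * I₃ (p.2, p.1)) +
        g p.1 p.2 * I₄ (p.1, p.2))
      ((((m2.const_mul _).add (m3.const_mul _)).add (m3'.const_mul _)).add m4),
    lintegral_two_mul_add_add_add _ m2 m3 m3', ← hp _ m2, ← hp _ m3, ← hp _ m3', ← hp _ m4, hswap]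
  ring

end Moments

/-! ### Ignoring the diagonal under a measure without atoms. -/

section Diffuse

variable {Y : Type*} [MeasurableSpace Y] (lam : Measure Y) [NullSingletonClass lam]

theorem lintegral_mul_congr_off_diag {g m : Y → Y → ℝ≥0∞} (h : ∀ s t, s ≠ t → g s t = m s t)
    (s : Y) (k : Y → ℝ≥0∞) : ∫⁻ t, g s t * k t ∂lam = ∫⁻ t, m s t * k t ∂lam := by
  refine lintegral_congr_ae ?_
  have : ∀ᵐ t ∂lam, t ≠ s := by
    rw [ae_iff]
    simp
  filter_upwards [this] with t ht
  rw [h s t ht.symm]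

end Diffuse

/-! ### Segments: measurability of intersection, differences of `L` and `N`, bounds on the weight.
-/

section Segments

variable {B : Set Plane} {b : ℝ}

theorem len_nonneg (y : Seg B b) : 0 ≤ len y := y.2.1.2.1.le

theorem len_le (y : Seg B b) : len y ≤ b := y.2.1.2.2

theorem measurable_len : Measurable (len : Seg B b → ℝ) := by
  unfold len
  fun_prop

theorem meet_eq_zero_or_one (s t : Seg B b) : meet s t = 0 ∨ meet s t = 1 := by
  rw [meet]
  split_ifs <;> simp

theorem meet_nonneg (s t : Seg B b) : 0 ≤ meet s t := by
  rcases meet_eq_zero_or_one s t with h | h <;> simp [h]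

theorem meet_le_one (s t : Seg B b) : meet s t ≤ 1 := by
  rcases meet_eq_zero_or_one s t with h | h <;> simp [h]

theorem meet_comm (s t : Seg B b) : meet s t = meet t s := by
  rw [meet, meet, Set.inter_comm]

/-- Two segments meet iff their parametrisations agree at some parameters in `[0, 1]`. This is a
closed condition on segments and parameters, and projecting along the compact square of parameters
preserves closedness. -/
theorem isClosed_setOf_meet :
    IsClosed {p : Seg B b × Seg B b | (carrier p.1 ∩ carrier p.2).Nonempty} := by
  let pt : Seg B b → ℝ → Plane := fun y θ =>
    (1 - θ) • ((y.1 : Plane) - (len y / 2) • !₂[Real.cos (y.2.2 : ℝ), Real.sin (y.2.2 : ℝ)]) +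
      θ • ((y.1 : Plane) + (len y / 2) • !₂[Real.cos (y.2.2 : ℝ), Real.sin (y.2.2 : ℝ)])
  have hdir : Continuous fun φ : ℝ => (!₂[Real.cos φ, Real.sin φ] : Plane) := by
    refine (PiLp.continuous_toLp 2 _).comp (continuous_pi fun i => ?_)
    fin_cases i
    · exact Real.continuous_cos
    · exact Real.continuous_sin
  have hpt : Continuous (uncurry pt) := by
    have h1 : Continuous fun q : Seg B b × ℝ =>
        (!₂[Real.cos (q.1.2.2 : ℝ), Real.sin (q.1.2.2 : ℝ)] : Plane) :=
      hdir.comp (f := fun q : Seg B b × ℝ => (q.1.2.2 : ℝ)) (by fun_prop)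
    have h2 : Continuous fun q : Seg B b × ℝ => len q.1 := by
      unfold len
      fun_prop
    simp only [pt, uncurry_def]
    fun_prop
  have hcar (y : Seg B b) : carrier y = pt y '' Set.Icc 0 1 := segment_eq_image ℝ _ _
  let I := Set.Icc (0 : ℝ) 1
  have hcl : IsClosed {q : (Seg B b × Seg B b) × (I × I) | pt q.1.1 q.2.1 = pt q.1.2 q.2.2} :=
    isClosed_eq (hpt.comp (f := fun q : (Seg B b × Seg B b) × (I × I) => (q.1.1, (q.2.1 : ℝ)))
      (by fun_prop)) (hpt.comp
        (f := fun q : (Seg B b × Seg B b) × (I × I) => (q.1.2, (q.2.2 : ℝ))) (by fun_prop))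
  convert isClosedMap_fst_of_compactSpace _ hcl using 1
  ext p
  simp only [hcar, Set.mem_ofPred_eq, Set.mem_image]
  constructor
  · rintro ⟨_, ⟨θ, hθ, rfl⟩, θ', hθ', h⟩
    exact ⟨(p, (⟨θ, hθ⟩, ⟨θ', hθ'⟩)), h.symm, rfl⟩
  · rintro ⟨⟨q, θ, θ'⟩, h, rfl⟩
    exact ⟨_, ⟨θ, θ.2, rfl⟩, θ', θ'.2, h.symm⟩

theorem measurable_meet : Measurable (uncurry (meet : Seg B b → Seg B b → ℝ)) := by
  classical
  simp only [uncurry_def, meet]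
  exact Measurable.ite isClosed_setOf_meet.measurableSet measurable_const measurable_const

open Classical in
/-- The indicator of the event that `s` and `t` are different and intersect. -/
noncomputable def meetNe (s t : Seg B b) : ℝ := if s ≠ t then meet s t else 0

theorem meetNe_self (s : Seg B b) : meetNe s s = 0 := by simp [meetNe]

theorem meetNe_of_ne {s t : Seg B b} (h : s ≠ t) : meetNe s t = meet s t := by simp [meetNe, h]

theorem meetNe_comm (s t : Seg B b) : meetNe s t = meetNe t s := by
  simp [meetNe, meet_comm s t, eq_comm]

theorem meetNe_nonneg (s t : Seg B b) : 0 ≤ meetNe s t := by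
  rw [meetNe]
  split_ifs
  exacts [meet_nonneg s t, le_rfl]

theorem meetNe_mul_self (s t : Seg B b) : meetNe s t * meetNe s t = meetNe s t := by
  rw [meetNe]
  rcases meet_eq_zero_or_one s t with h | h <;> simp [h]

theorem measurable_meetNe : Measurable (uncurry (meetNe : Seg B b → Seg B b → ℝ)) := by
  classical
  simp only [uncurry_def, meetNe]
  exact Measurable.ite (measurableSet_eq_fun measurable_fst measurable_snd).compl measurable_meet
    measurable_const

theorem totalLength_cons (s : Seg B b) (x : Multiset (Seg B b)) :
    totalLength (s ::ₘ x) = len s + totalLength x := by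
  simp [totalLength]

theorem numIntersections_eq (x : Multiset (Seg B b)) :
    numIntersections x = (1 / 2) * (x.map fun s => (x.map (meetNe s)).sum).sum := rfl

/-- The factor `1 / 2` cancels the double occurrence of `s` in ordered pairs. -/
theorem numIntersections_cons (s : Seg B b) (x : Multiset (Seg B b)) :
    numIntersections (s ::ₘ x) = numIntersections x + (x.map (meetNe s)).sum := by
  simp only [numIntersections_eq, Multiset.map_cons, Multiset.sum_cons, meetNe_self, zero_add,
    Multiset.sum_map_add]
  simp_rw [fun t => meetNe_comm t s]
  ring

theorem diff_totalLength (y : Seg B b) (x : Multiset (Seg B b)) :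
    diff y totalLength x = len y := by
  simp [diff, totalLength_cons]

theorem diff_numIntersections (y : Seg B b) (x : Multiset (Seg B b)) :
    diff y numIntersections x = (x.map (meetNe y)).sum := by
  simp [diff, numIntersections_cons]

theorem diff₂_totalLength (y z : Seg B b) (x : Multiset (Seg B b)) :
    diff₂ y z totalLength x = 0 := by
  simp [diff₂, diff, totalLength_cons]

/-- The value does not depend on `x`: `N` is quadratic, which is why no third differences occur in
`𝓔`. -/
theorem diff₂_numIntersections (y z : Seg B b) (x : Multiset (Seg B b)) :
    diff₂ y z numIntersections x = meetNe y z := by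
  rw [diff₂, diff, diff_numIntersections, diff_numIntersections]
  simp [meetNe_comm z y]

theorem expDiff_eq (ν₁ ν₂ : ℝ) {m : ℕ} (y : Fin m → Seg B b) (x : Multiset (Seg B b)) :
    expDiff ν₁ ν₂ y x = Real.exp ((∑ i, (ν₁ * len (y i) + ν₂ * (x.map (meetNe (y i))).sum)) +
      ∑ i, ∑ j ∈ Finset.Ioi i, ν₂ * meetNe (y i) (y j)) := by
  simp [expDiff, diff_totalLength, diff_numIntersections, diff₂_totalLength,
    diff₂_numIntersections]

theorem map_meetNe_ofPoints_sum (s : Seg B b) {m : ℕ} (y : Fin m → Seg B b) :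
    ((ofPoints y).map (meetNe s)).sum = ∑ i, meetNe s (y i) := by
  rw [ofPoints, Multiset.map_map]
  rfl

/-- The density ratio of `x + δ_{y_1} + ⋯ + δ_{y_m}` and `x` is `𝓔_x(y_1, …, y_m)`. -/
theorem weight_ofPoints_add (ν₁ ν₂ : ℝ) (x : Multiset (Seg B b)) :
    ∀ {m : ℕ} (y : Fin m → Seg B b),
      weight ν₁ ν₂ (ofPoints y + x) = weight ν₁ ν₂ x * expDiff ν₁ ν₂ y x
  | 0, y => by simp [ofPoints_zero, expDiff_eq]
  | m + 1, y => by
    have ih := weight_ofPoints_add ν₁ ν₂ x (Fin.tail y)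
    rw [weight, weight, expDiff_eq, ← Real.exp_add, Real.exp_eq_exp] at ih
    -- Compare exponents: the head `y 0` adds its length, its intersections with `x` and those with
    -- the tail, which are the terms of the double sum with `i = 0`.
    rw [weight, weight, expDiff_eq, ← Real.exp_add, Real.exp_eq_exp, ← Fin.cons_self_tail y,
      ofPoints_cons, Multiset.cons_add, totalLength_cons, numIntersections_cons, Multiset.map_add,
      Multiset.sum_add, map_meetNe_ofPoints_sum]
    simp only [Fin.sum_univ_succ, Fin.cons_zero, Fin.cons_succ, Fin.sum_Ioi_zero, Fin.sum_Ioi_succ,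
      ← Finset.mul_sum] at ih ⊢
    linarith

theorem map_meetNe_sum_nonneg (s : Seg B b) (x : Multiset (Seg B b)) :
    0 ≤ (x.map (meetNe s)).sum :=
  Multiset.sum_nonneg fun a ha => by
    obtain ⟨t, -, rfl⟩ := Multiset.mem_map.1 ha
    exact meetNe_nonneg s t

theorem mul_len_le (ν₁ : ℝ) (s : Seg B b) : ν₁ * len s ≤ |ν₁| * b :=
  (mul_le_mul_of_nonneg_right (le_abs_self ν₁) (len_nonneg s)).trans
    (mul_le_mul_of_nonneg_left (len_le s) (abs_nonneg ν₁))

theorem expDiff_pos (ν₁ ν₂ : ℝ) {m : ℕ} (y : Fin m → Seg B b) (x : Multiset (Seg B b)) :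
    0 < expDiff ν₁ ν₂ y x := Real.exp_pos _

/-- Each added segment contributes at most `|ν₁| * b` through its length; the intersection terms are
nonpositive. The bound is uniform in `x`. -/
theorem expDiff_le (ν₁ : ℝ) {ν₂ : ℝ} (hν₂ : ν₂ ≤ 0) {m : ℕ} (y : Fin m → Seg B b)
    (x : Multiset (Seg B b)) : expDiff ν₁ ν₂ y x ≤ Real.exp (m * (|ν₁| * b)) := by
  rw [expDiff_eq, Real.exp_le_exp]
  have h1 : ∑ i, (ν₁ * len (y i) + ν₂ * (x.map (meetNe (y i))).sum) ≤ m * (|ν₁| * b) := by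
    calc _ ≤ ∑ _i : Fin m, |ν₁| * b := Finset.sum_le_sum fun i _ => by
          linarith [mul_len_le ν₁ (y i),
            mul_nonpos_of_nonpos_of_nonneg hν₂ (map_meetNe_sum_nonneg (y i) x)]
      _ = _ := by simp
  have h2 : ∑ i, ∑ j ∈ Finset.Ioi i, ν₂ * meetNe (y i) (y j) ≤ 0 :=
    Finset.sum_nonpos fun i _ => Finset.sum_nonpos fun j _ =>
      mul_nonpos_of_nonpos_of_nonneg hν₂ (meetNe_nonneg _ _)
  linarith

theorem weight_pos (ν₁ ν₂ : ℝ) (x : Multiset (Seg B b)) : 0 < weight ν₁ ν₂ x := Real.exp_pos _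

/-- Stability of the energy: growth is at most geometric in the number of points, and the Poisson
law integrates such functions. -/
theorem weight_le (ν₁ : ℝ) {ν₂ : ℝ} (hν₂ : ν₂ ≤ 0) (x : Multiset (Seg B b)) :
    weight ν₁ ν₂ x ≤ Real.exp (|ν₁| * b) ^ count Set.univ x := by
  induction x using Multiset.induction_on with
  | empty => simp [weight, totalLength, numIntersections, count]
  | cons s x ih =>
    have h : weight ν₁ ν₂ (s ::ₘ x) =
        Real.exp (ν₁ * len s + ν₂ * (x.map (meetNe s)).sum) * weight ν₁ ν₂ x := by
      rw [weight, weight, ← Real.exp_add, totalLength_cons, numIntersections_cons]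
      congr 1
      ring
    rw [h, ← Multiset.singleton_add, count_add, count_singleton, pow_add]
    refine mul_le_mul ?_ ih (Real.exp_pos _).le (by positivity)
    simp only [Set.indicator_univ, Pi.one_apply, pow_one, Real.exp_le_exp]
    linarith [mul_len_le ν₁ s, mul_nonpos_of_nonpos_of_nonneg hν₂ (map_meetNe_sum_nonneg s x)]

theorem ofReal_multiset_sum {α : Type*} {f : α → ℝ} (hf : ∀ a, 0 ≤ f a) (x : Multiset α) :
    ENNReal.ofReal (x.map f).sum = (x.map fun a => ENNReal.ofReal (f a)).sum := by
  induction x using Multiset.induction_on with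
  | empty => simp
  | cons a x ih =>
    rw [Multiset.map_cons, Multiset.map_cons, Multiset.sum_cons, Multiset.sum_cons,
      ENNReal.ofReal_add (hf a), ih]
    exact Multiset.sum_nonneg fun c hc => by
      obtain ⟨t, -, rfl⟩ := Multiset.mem_map.1 hc
      exact hf t

theorem measurable_multiset_sum_real {α Y : Type*} [MeasurableSpace α] [MeasurableSpace Y]
    {f : α → Y → ℝ} (h0 : ∀ a s, 0 ≤ f a s) {x : α → Multiset Y} (hf : Measurable (uncurry f))
    (hx : Measurable x) : Measurable fun a => ((x a).map (f a)).sum := by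
  have h : Measurable fun a => ENNReal.ofReal (((x a).map (f a)).sum) := by
    simp_rw [fun a => ofReal_multiset_sum (h0 a)]
    exact measurable_config_sum (f := fun a s => ENNReal.ofReal (f a s)) hf.ennreal_ofReal hx
  convert h.ennreal_toReal using 2 with a
  rw [ENNReal.toReal_ofReal]
  exact Multiset.sum_nonneg fun c hc => by
    obtain ⟨t, -, rfl⟩ := Multiset.mem_map.1 hc
    exact h0 a t

theorem ofReal_totalLength (x : Multiset (Seg B b)) :
    ENNReal.ofReal (totalLength x) = (x.map fun s => ENNReal.ofReal (len s)).sum :=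
  ofReal_multiset_sum len_nonneg x

theorem totalLength_nonneg (x : Multiset (Seg B b)) : 0 ≤ totalLength x :=
  Multiset.sum_nonneg fun c hc => by
    obtain ⟨t, -, rfl⟩ := Multiset.mem_map.1 hc
    exact len_nonneg t

theorem numIntersections_nonneg (x : Multiset (Seg B b)) : 0 ≤ numIntersections x :=
  mul_nonneg (by norm_num) <| Multiset.sum_nonneg fun c hc => by
    obtain ⟨t, -, rfl⟩ := Multiset.mem_map.1 hc
    exact map_meetNe_sum_nonneg t x

theorem ofReal_numIntersections (x : Multiset (Seg B b)) :
    ENNReal.ofReal (numIntersections x) =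
      ENNReal.ofReal (1 / 2) * pairSum (fun s t => ENNReal.ofReal (meetNe s t)) x := by
  rw [pairSum]
  simp_rw [← fun s => ofReal_multiset_sum (meetNe_nonneg s)]
  rw [← ofReal_multiset_sum fun s => map_meetNe_sum_nonneg s x, numIntersections_eq,
    ENNReal.ofReal_mul (by norm_num)]

theorem measurable_totalLength : Measurable (totalLength : Multiset (Seg B b) → ℝ) :=
  measurable_multiset_sum_real (f := fun _ => len) (fun _ => len_nonneg)
    (measurable_len.comp measurable_snd) measurable_id

theorem measurable_map_meetNe_sum {α : Type*} [MeasurableSpace α] {a : α → Seg B b}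
    {x : α → Multiset (Seg B b)} (ha : Measurable a) (hx : Measurable x) :
    Measurable fun p => ((x p).map (meetNe (a p))).sum :=
  measurable_multiset_sum_real (f := fun p => meetNe (a p)) (fun _ => meetNe_nonneg _)
    (measurable_meetNe.comp ((ha.comp measurable_fst).prodMk measurable_snd)) hx

theorem measurable_numIntersections : Measurable (numIntersections : Multiset (Seg B b) → ℝ) :=
  (measurable_multiset_sum_real (f := fun x s => (x.map (meetNe s)).sum)
    (fun x s => map_meetNe_sum_nonneg s x)
    (measurable_map_meetNe_sum measurable_snd measurable_fst) measurable_id).const_mul _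

theorem measurable_weight (ν₁ ν₂ : ℝ) :
    Measurable (weight ν₁ ν₂ : Multiset (Seg B b) → ℝ) :=
  ((measurable_totalLength.const_mul ν₁).add (measurable_numIntersections.const_mul ν₂)).exp

theorem measurable_expDiff (ν₁ ν₂ : ℝ) (m : ℕ) :
    Measurable (uncurry fun (y : Fin m → Seg B b) => expDiff ν₁ ν₂ y) := by
  simp only [uncurry_def, expDiff_eq]
  have hy (i : Fin m) :
      Measurable fun p : (Fin m → Seg B b) × Multiset (Seg B b) => p.1 i := by fun_prop
  refine Measurable.exp (Measurable.add ?_ ?_)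
  · exact Finset.measurable_sum _ fun i _ => ((measurable_len.comp (hy i)).const_mul _).add
      ((measurable_map_meetNe_sum (hy i) measurable_snd).const_mul _)
  · exact Finset.measurable_sum _ fun i _ => Finset.measurable_sum _ fun j _ =>
      (measurable_meetNe.comp ((hy i).prodMk (hy j))).const_mul _

end Segments

/-! ### The intensity measure is finite and has no atoms. -/

section Intensity

variable {B : Set Plane} {b : ℝ}

theorem isFiniteMeasure_intensity (hB : MeasurableSet B) (hBbdd : Bornology.IsBounded B)
    (ρ : B → NNReal) (hρbdd : ∃ M : NNReal, ∀ z, ρ z ≤ M)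
    (Q : Measure (Set.Ioc (0 : ℝ) b)) [IsProbabilityMeasure Q]
    (V : Measure (Set.Ico (0 : ℝ) Real.pi)) [IsProbabilityMeasure V] :
    IsFiniteMeasure (intensity ρ Q V) := by
  obtain ⟨M, hM⟩ := hρbdd
  have : IsFiniteMeasure
      ((volume.comap (Subtype.val : B → Plane)).withDensity fun z => (ρ z : ENNReal)) := by
    refine isFiniteMeasure_withDensity (ne_of_lt ?_)
    calc ∫⁻ z, (ρ z : ENNReal) ∂(volume.comap (Subtype.val : B → Plane))
        ≤ ∫⁻ _, (M : ENNReal) ∂(volume.comap (Subtype.val : B → Plane)) :=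
          lintegral_mono fun z => ENNReal.coe_le_coe.2 (hM z)
      _ < ∞ := by
        rw [lintegral_const, comap_subtype_coe_apply hB]
        refine ENNReal.mul_lt_top ENNReal.coe_lt_top ?_
        simpa using hBbdd.measure_lt_top
  unfold intensity
  infer_instance

theorem nullSingletonClass_intensity (ρ : B → NNReal)
    (Q : Measure (Set.Ioc (0 : ℝ) b)) [IsProbabilityMeasure Q]
    (V : Measure (Set.Ico (0 : ℝ) Real.pi)) [IsProbabilityMeasure V]
    (hB : MeasurableSet B) :
    NullSingletonClass (intensity ρ Q V) := by
  have : NullSingletonClass (volume.comap (Subtype.val : B → Plane)) :=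
    ⟨fun z => by rw [comap_subtype_coe_apply hB]; simp⟩
  have : NullSingletonClass
      ((volume.comap (Subtype.val : B → Plane)).withDensity fun z => (ρ z : ENNReal)) :=
    ⟨fun z => withDensity_absolutelyContinuous _ _ (measure_singleton z)⟩
  unfold intensity
  infer_instance

end Intensity

theorem measurable_meet_apply {B : Set Plane} {b : ℝ} {m : ℕ} (i j : Fin m) :
    Measurable fun y : Fin m → Seg B b => meet (y i) (y j) := by
  have h : Measurable fun y : Fin m → Seg B b => (y i, y j) := by fun_prop
  simpa only [comp_def, uncurry_apply_pair] using measurable_meet.comp h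

/-- Since `N` is half of a `pairSum`, the square brings a factor `1 / 4`, which turns the
coefficients 2, 4, 1 into `1 / 2`, 1, `1 / 4`. -/
theorem ofReal_half_sq_mul {a b c : ℝ} (ha : 0 ≤ a) (hb : 0 ≤ b) (hc : 0 ≤ c) :
    ENNReal.ofReal (1 / 2) ^ 2 *
        (2 * ENNReal.ofReal a + 4 * ENNReal.ofReal b + ENNReal.ofReal c) =
      ENNReal.ofReal (1 / 2 * a + b + 1 / 4 * c) := by
  rw [← ENNReal.ofReal_ofNat 2, ← ENNReal.ofReal_ofNat 4, ← ENNReal.ofReal_mul zero_le_two,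
    ← ENNReal.ofReal_mul zero_le_four, ← ENNReal.ofReal_add (by positivity) (by positivity),
    ← ENNReal.ofReal_add (by positivity) hc, ← ENNReal.ofReal_pow (by norm_num),
    ← ENNReal.ofReal_mul (by norm_num)]
  congr 1
  ring

/-! ### The Gibbs process: normalisation, correlation functions, moments in `ℝ≥0∞`. -/

section Gibbs

variable {B : Set Plane} {b : ℝ} (lam : Measure (Seg B b)) [IsFiniteMeasure lam]
  (ν₁ : ℝ) {ν₂ : ℝ}

theorem integrable_weight (hν₂ : ν₂ ≤ 0) : Integrable (weight ν₁ ν₂) (poissonLaw lam) := by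
  refine ⟨(measurable_weight ν₁ ν₂).aestronglyMeasurable, ?_⟩
  rw [hasFiniteIntegral_iff_ofReal (ae_of_all _ fun x => (weight_pos ν₁ ν₂ x).le)]
  exact (lintegral_mono fun x => ENNReal.ofReal_le_ofReal (weight_le ν₁ hν₂ x)).trans_lt
    (lintegral_pow_card_poissonLaw_lt_top lam (Real.exp_pos _).le)

theorem normConst_pos (hν₂ : ν₂ ≤ 0) : 0 < normConst lam ν₁ ν₂ := by
  rw [normConst, integral_pos_iff_support_of_nonneg (fun x => (weight_pos ν₁ ν₂ x).le)
    (integrable_weight lam ν₁ hν₂)]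
  have : support (weight ν₁ ν₂ : Multiset (Seg B b) → ℝ) = Set.univ :=
    Set.eq_univ_of_forall fun x => (Real.exp_pos _).ne'
  rw [this]
  exact pos_iff_ne_zero.2 (poissonLaw_univ_pos lam)

theorem isProbabilityMeasure_gibbsLaw (hν₂ : ν₂ ≤ 0) :
    IsProbabilityMeasure (gibbsLaw lam ν₁ ν₂) := by
  have hc := normConst_pos lam ν₁ hν₂
  constructor
  rw [gibbsLaw, withDensity_apply _ MeasurableSet.univ, Measure.restrict_univ,
    ← ofReal_integral_eq_lintegral_ofReal ((integrable_weight lam ν₁ hν₂).const_mul _)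
      (ae_of_all _ fun x => mul_nonneg (inv_nonneg.2 hc.le) (Real.exp_pos _).le),
    integral_const_mul]
  change ENNReal.ofReal (_ * normConst lam ν₁ ν₂) = 1
  rw [inv_mul_cancel₀ hc.ne', ENNReal.ofReal_one]

/-- The density of the Gibbs segment process. -/
noncomputable def density (ν₁ ν₂ : ℝ) (x : Multiset (Seg B b)) : ℝ≥0∞ :=
  ENNReal.ofReal ((normConst lam ν₁ ν₂)⁻¹ * weight ν₁ ν₂ x)

omit [IsFiniteMeasure lam] in
theorem measurable_density (ν₂ : ℝ) : Measurable (density lam ν₁ ν₂) :=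
  ((measurable_weight ν₁ ν₂).const_mul _).ennreal_ofReal

omit [IsFiniteMeasure lam] in
theorem lintegral_gibbsLaw (ν₂ : ℝ) {F : Multiset (Seg B b) → ℝ≥0∞} (hF : Measurable F) :
    ∫⁻ x, F x ∂(gibbsLaw lam ν₁ ν₂) = ∫⁻ x, F x * density lam ν₁ ν₂ x ∂(poissonLaw lam) := by
  rw [gibbsLaw]
  refine (lintegral_withDensity_eq_lintegral_mul _ (measurable_density lam ν₁ ν₂) hF).trans ?_
  simp_rw [Pi.mul_apply, mul_comm]

theorem integrable_expDiff (hν₂ : ν₂ ≤ 0) {m : ℕ} (y : Fin m → Seg B b) :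
    Integrable (expDiff ν₁ ν₂ y) (gibbsLaw lam ν₁ ν₂) := by
  have := isProbabilityMeasure_gibbsLaw lam ν₁ hν₂
  refine Integrable.of_bound
    ((measurable_expDiff ν₁ ν₂ m).comp measurable_prodMk_left).aestronglyMeasurable
    (Real.exp (m * (|ν₁| * b))) (ae_of_all _ fun x => ?_)
  rw [Real.norm_of_nonneg (expDiff_pos ν₁ ν₂ y x).le]
  exact expDiff_le ν₁ hν₂ y x

omit [IsFiniteMeasure lam] in
theorem meanExpDiff_nonneg (ν₂ : ℝ) {m : ℕ} (y : Fin m → Seg B b) :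
    0 ≤ meanExpDiff lam ν₁ ν₂ y :=
  integral_nonneg fun x => (expDiff_pos ν₁ ν₂ y x).le

theorem meanExpDiff_le (hν₂ : ν₂ ≤ 0) {m : ℕ} (y : Fin m → Seg B b) :
    meanExpDiff lam ν₁ ν₂ y ≤ Real.exp (m * (|ν₁| * b)) := by
  have := isProbabilityMeasure_gibbsLaw lam ν₁ hν₂
  simpa [meanExpDiff] using
    integral_mono (integrable_expDiff lam ν₁ hν₂ y) (integrable_const (Real.exp (m * (|ν₁| * b))))
      (expDiff_le ν₁ hν₂ y)

/-- By `weight_ofPoints_add` the shifted density is the density times `𝓔_x(y)`, and integrating the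
density against the Poisson law is integrating against the Gibbs law. -/
theorem correlation_density (hν₂ : ν₂ ≤ 0) {m : ℕ} (y : Fin m → Seg B b) :
    correlation lam (density lam ν₁ ν₂) (ofPoints y) =
      ENNReal.ofReal (meanExpDiff lam ν₁ ν₂ y) := by
  rw [meanExpDiff, ofReal_integral_eq_lintegral_ofReal (integrable_expDiff lam ν₁ hν₂ y)
    (ae_of_all _ fun x => (expDiff_pos ν₁ ν₂ y x).le),
    lintegral_gibbsLaw lam ν₁ ν₂ (F := fun x => ENNReal.ofReal (expDiff ν₁ ν₂ y x))
      ((measurable_expDiff ν₁ ν₂ m).comp measurable_prodMk_left).ennreal_ofReal, correlation]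
  congr 1 with x
  rw [density, density, weight_ofPoints_add, ← mul_assoc, mul_comm,
    ENNReal.ofReal_mul (expDiff_pos ν₁ ν₂ y x).le]

theorem measurable_meanExpDiff (hν₂ : ν₂ ≤ 0) (m : ℕ) :
    Measurable fun y : Fin m → Seg B b => meanExpDiff lam ν₁ ν₂ y := by
  -- Measurability in `y` is read off from the correlation function, which is measurable in the
  -- configuration.
  have h := ((measurable_correlation lam (measurable_density lam ν₁ ν₂)).comp
    (measurable_ofPoints m)).ennreal_toReal
  convert h using 2 with y
  rw [comp_apply, correlation_density lam ν₁ hν₂,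
    ENNReal.toReal_ofReal (meanExpDiff_nonneg lam ν₁ ν₂ y)]

theorem integrable_meanExpDiff_mul (hν₂ : ν₂ ≤ 0) {α : Type*} [MeasurableSpace α]
    {P : Measure α} [IsFiniteMeasure P] {m : ℕ} {y : α → Fin m → Seg B b} (hy : Measurable y)
    {a : α → ℝ} (ha : Measurable a) {C : ℝ} (h0 : ∀ p, 0 ≤ a p) (hC : ∀ p, a p ≤ C) :
    Integrable (fun p => meanExpDiff lam ν₁ ν₂ (y p) * a p) P := by
  refine Integrable.of_bound
    (((measurable_meanExpDiff lam ν₁ hν₂ m).comp hy).mul ha).aestronglyMeasurable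
    (Real.exp (m * (|ν₁| * b)) * C) (ae_of_all _ fun p => ?_)
  rw [Real.norm_of_nonneg (mul_nonneg (meanExpDiff_nonneg lam ν₁ ν₂ _) (h0 p))]
  exact mul_le_mul (meanExpDiff_le lam ν₁ hν₂ _) (hC p) (h0 p) (Real.exp_pos _).le

theorem integrable_meanExpDiff_mul_len (hν₂ : ν₂ ≤ 0) :
    Integrable (fun y => meanExpDiff lam ν₁ ν₂ ![y] * len y) lam :=
  integrable_meanExpDiff_mul lam ν₁ hν₂ (by fun_prop) measurable_len len_nonneg len_le

theorem integrable_meanExpDiff_mul_len_sq (hν₂ : ν₂ ≤ 0) :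
    Integrable (fun y => meanExpDiff lam ν₁ ν₂ ![y] * len y ^ 2) lam :=
  integrable_meanExpDiff_mul lam ν₁ hν₂ (by fun_prop) (measurable_len.pow_const 2)
    (fun y => sq_nonneg _) (fun y => pow_le_pow_left₀ (len_nonneg y) (len_le y) 2)

theorem integrable_meanExpDiff_mul_len_mul_len (hν₂ : ν₂ ≤ 0) :
    Integrable (fun y : Fin 2 → Seg B b =>
      meanExpDiff lam ν₁ ν₂ y * len (y 0) * len (y 1)) (Measure.pi fun _ => lam) := by
  have hl := measurable_len (B := B) (b := b)
  simp_rw [mul_assoc]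
  exact integrable_meanExpDiff_mul lam ν₁ hν₂ measurable_id
    (a := fun y => len (y 0) * len (y 1)) (by fun_prop)
    (fun y => mul_nonneg (len_nonneg _) (len_nonneg _))
    (fun y => mul_le_mul (len_le _) (len_le _) (len_nonneg _) ((len_nonneg _).trans (len_le (y 0))))

theorem integrable_meanExpDiff_mul_meet (hν₂ : ν₂ ≤ 0) :
    Integrable (fun y : Fin 2 → Seg B b => meanExpDiff lam ν₁ ν₂ y * meet (y 0) (y 1))
      (Measure.pi fun _ => lam) :=
  integrable_meanExpDiff_mul lam ν₁ hν₂ measurable_id (measurable_meet_apply 0 1)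
    (fun _ => meet_nonneg _ _) (fun _ => meet_le_one _ _)

theorem integrable_meanExpDiff_mul_meet_mul_meet (hν₂ : ν₂ ≤ 0) {m : ℕ} (i j k l : Fin m) :
    Integrable (fun y : Fin m → Seg B b =>
      meanExpDiff lam ν₁ ν₂ y * meet (y i) (y j) * meet (y k) (y l))
      (Measure.pi fun _ => lam) := by
  simp_rw [mul_assoc]
  exact integrable_meanExpDiff_mul lam ν₁ hν₂ measurable_id
    ((measurable_meet_apply i j).mul (measurable_meet_apply k l))
    (fun y => mul_nonneg (meet_nonneg _ _) (meet_nonneg _ _))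
    (fun y => mul_le_one₀ (meet_le_one _ _) (meet_nonneg _ _) (meet_le_one _ _))

/-- This lemma and its analogues below translate the real integrals of the final formulas into the
iterated integrals of correlation functions that the Mecke equation produces. -/
theorem ofReal_integral_meanExpDiff_mul_len (hν₂ : ν₂ ≤ 0) :
    ENNReal.ofReal (∫ y, meanExpDiff lam ν₁ ν₂ ![y] * len y ∂lam) =
      ∫⁻ s, ENNReal.ofReal (len s) * correlation lam (density lam ν₁ ν₂) {s} ∂lam := by
  rw [ofReal_integral_eq_lintegral_ofReal (integrable_meanExpDiff_mul_len lam ν₁ hν₂)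
    (ae_of_all _ fun y => mul_nonneg (meanExpDiff_nonneg lam ν₁ ν₂ _) (len_nonneg y))]
  congr 1 with s
  rw [mul_comm, ENNReal.ofReal_mul (len_nonneg s), ← correlation_density lam ν₁ hν₂]
  rfl

theorem ofReal_integral_meanExpDiff_mul_len_sq (hν₂ : ν₂ ≤ 0) :
    ENNReal.ofReal (∫ y, meanExpDiff lam ν₁ ν₂ ![y] * len y ^ 2 ∂lam) =
      ∫⁻ s, ENNReal.ofReal (len s) ^ 2 * correlation lam (density lam ν₁ ν₂) {s} ∂lam := by
  rw [ofReal_integral_eq_lintegral_ofReal (integrable_meanExpDiff_mul_len_sq lam ν₁ hν₂)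
    (ae_of_all _ fun y => mul_nonneg (meanExpDiff_nonneg lam ν₁ ν₂ _) (sq_nonneg _))]
  congr 1 with s
  rw [mul_comm, ENNReal.ofReal_mul (sq_nonneg _), ← correlation_density lam ν₁ hν₂,
    ENNReal.ofReal_pow (len_nonneg s)]
  rfl

theorem ofReal_integral_meanExpDiff_mul_len_mul_len (hν₂ : ν₂ ≤ 0) :
    ENNReal.ofReal (∫ y : Fin 2 → Seg B b,
        meanExpDiff lam ν₁ ν₂ y * len (y 0) * len (y 1) ∂(Measure.pi fun _ => lam)) =
      ∫⁻ s, ENNReal.ofReal (len s) * ∫⁻ t, ENNReal.ofReal (len t) *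
        correlation lam (density lam ν₁ ν₂) {s, t} ∂lam ∂lam := by
  have hm := measurable_meanExpDiff lam ν₁ hν₂ 2
  have hl := measurable_len (B := B) (b := b)
  rw [ofReal_integral_eq_lintegral_ofReal (integrable_meanExpDiff_mul_len_mul_len lam ν₁ hν₂)
    (ae_of_all _ fun y => mul_nonneg (mul_nonneg (meanExpDiff_nonneg lam ν₁ ν₂ _) (len_nonneg _))
      (len_nonneg _)), lintegral_pi_fin_two lam (by fun_prop)]
  congr 1 with s
  rw [← lintegral_const_mul' _ _ ENNReal.ofReal_ne_top]
  congr 1 with t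
  change ENNReal.ofReal (_ * len s * len t) = _ * (_ * correlation lam _ (ofPoints ![s, t]))
  rw [correlation_density lam ν₁ hν₂, ← ENNReal.ofReal_mul (len_nonneg t),
    ← ENNReal.ofReal_mul (len_nonneg s)]
  congr 1
  ring

theorem ofReal_integral_meanExpDiff_mul_meet (hν₂ : ν₂ ≤ 0) :
    ENNReal.ofReal (∫ y : Fin 2 → Seg B b,
        meanExpDiff lam ν₁ ν₂ y * meet (y 0) (y 1) ∂(Measure.pi fun _ => lam)) =
      ∫⁻ s, ∫⁻ t, ENNReal.ofReal (meet s t) *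
        correlation lam (density lam ν₁ ν₂) {s, t} ∂lam ∂lam := by
  have hm := measurable_meanExpDiff lam ν₁ hν₂ 2
  have hm1 := measurable_meet_apply (B := B) (b := b) (m := 2) 0 1
  rw [ofReal_integral_eq_lintegral_ofReal (integrable_meanExpDiff_mul_meet lam ν₁ hν₂)
    (ae_of_all _ fun y => mul_nonneg (meanExpDiff_nonneg lam ν₁ ν₂ _) (meet_nonneg _ _)),
    lintegral_pi_fin_two lam (by fun_prop)]
  congr 1 with s
  congr 1 with t
  change ENNReal.ofReal (_ * meet s t) = _ * correlation lam _ (ofPoints ![s, t])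
  rw [correlation_density lam ν₁ hν₂, ← ENNReal.ofReal_mul (meet_nonneg s t), mul_comm]

theorem ofReal_integral_meanExpDiff_mul_meet_three (hν₂ : ν₂ ≤ 0) :
    ENNReal.ofReal (∫ y : Fin 3 → Seg B b,
        meanExpDiff lam ν₁ ν₂ y * meet (y 0) (y 1) * meet (y 2) (y 0)
          ∂(Measure.pi fun _ => lam)) =
      ∫⁻ s, ∫⁻ t, ENNReal.ofReal (meet s t) * ∫⁻ u, ENNReal.ofReal (meet s u) *
        correlation lam (density lam ν₁ ν₂) {s, t, u} ∂lam ∂lam ∂lam := by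
  have hm := measurable_meanExpDiff lam ν₁ hν₂ 3
  have hm1 := measurable_meet_apply (B := B) (b := b) (m := 3) 0 1
  have hm2 := measurable_meet_apply (B := B) (b := b) (m := 3) 2 0
  rw [ofReal_integral_eq_lintegral_ofReal
      (integrable_meanExpDiff_mul_meet_mul_meet lam ν₁ hν₂ 0 1 2 0)
    (ae_of_all _ fun y => mul_nonneg (mul_nonneg (meanExpDiff_nonneg lam ν₁ ν₂ _)
      (meet_nonneg _ _)) (meet_nonneg _ _)),
    lintegral_pi_fin_three lam (by fun_prop)]
  congr 1 with s
  congr 1 with t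
  rw [← lintegral_const_mul' _ _ ENNReal.ofReal_ne_top]
  congr 1 with u
  change ENNReal.ofReal (_ * meet s t * meet u s) =
    _ * (_ * correlation lam _ (ofPoints ![s, t, u]))
  rw [correlation_density lam ν₁ hν₂, ← ENNReal.ofReal_mul (meet_nonneg s u),
    ← ENNReal.ofReal_mul (meet_nonneg s t), meet_comm u s]
  congr 1
  ring

theorem ofReal_integral_meanExpDiff_mul_meet_four (hν₂ : ν₂ ≤ 0) :
    ENNReal.ofReal (∫ y : Fin 4 → Seg B b,
        meanExpDiff lam ν₁ ν₂ y * meet (y 0) (y 1) * meet (y 2) (y 3)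
          ∂(Measure.pi fun _ => lam)) =
      ∫⁻ s, ∫⁻ t, ENNReal.ofReal (meet s t) * ∫⁻ u, ∫⁻ v, ENNReal.ofReal (meet u v) *
        correlation lam (density lam ν₁ ν₂) {s, t, u, v} ∂lam ∂lam ∂lam ∂lam := by
  have hm := measurable_meanExpDiff lam ν₁ hν₂ 4
  have hm1 := measurable_meet_apply (B := B) (b := b) (m := 4) 0 1
  have hm2 := measurable_meet_apply (B := B) (b := b) (m := 4) 2 3
  rw [ofReal_integral_eq_lintegral_ofReal
      (integrable_meanExpDiff_mul_meet_mul_meet lam ν₁ hν₂ 0 1 2 3)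
    (ae_of_all _ fun y => mul_nonneg (mul_nonneg (meanExpDiff_nonneg lam ν₁ ν₂ _)
      (meet_nonneg _ _)) (meet_nonneg _ _)),
    lintegral_pi_fin_four lam (by fun_prop)]
  congr 1 with s
  congr 1 with t
  rw [← lintegral_const_mul' _ _ ENNReal.ofReal_ne_top]
  congr 1 with u
  rw [← lintegral_const_mul' _ _ ENNReal.ofReal_ne_top]
  congr 1 with v
  change ENNReal.ofReal (_ * meet s t * meet u v) =
    _ * (_ * correlation lam _ (ofPoints ![s, t, u, v]))
  rw [correlation_density lam ν₁ hν₂, ← ENNReal.ofReal_mul (meet_nonneg u v),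
    ← ENNReal.ofReal_mul (meet_nonneg s t)]
  congr 1
  ring

theorem lintegral_totalLength (hν₂ : ν₂ ≤ 0) :
    ∫⁻ x, ENNReal.ofReal (totalLength x) ∂(gibbsLaw lam ν₁ ν₂) =
      ENNReal.ofReal (∫ y, meanExpDiff lam ν₁ ν₂ ![y] * len y ∂lam) := by
  rw [lintegral_gibbsLaw lam ν₁ ν₂ measurable_totalLength.ennreal_ofReal,
    ofReal_integral_meanExpDiff_mul_len lam ν₁ hν₂]
  simp_rw [ofReal_totalLength]
  simpa using lintegral_map_sum_mul_correlation lam measurable_len.ennreal_ofReal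
    (measurable_density lam ν₁ ν₂) 0

theorem lintegral_totalLength_sq (hν₂ : ν₂ ≤ 0) :
    ∫⁻ x, ENNReal.ofReal (totalLength x ^ 2) ∂(gibbsLaw lam ν₁ ν₂) =
      ENNReal.ofReal ((∫ y, meanExpDiff lam ν₁ ν₂ ![y] * len y ^ 2 ∂lam) +
        (∫ y : Fin 2 → Seg B b,
          meanExpDiff lam ν₁ ν₂ y * len (y 0) * len (y 1) ∂(Measure.pi fun _ => lam))) := by
  rw [lintegral_gibbsLaw lam ν₁ ν₂ (measurable_totalLength.pow_const 2).ennreal_ofReal,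
    ENNReal.ofReal_add
      (integral_nonneg fun y => mul_nonneg (meanExpDiff_nonneg lam ν₁ ν₂ _) (sq_nonneg _))
      (integral_nonneg fun y => mul_nonneg (mul_nonneg (meanExpDiff_nonneg lam ν₁ ν₂ _)
        (len_nonneg _)) (len_nonneg _)),
    ofReal_integral_meanExpDiff_mul_len_sq lam ν₁ hν₂,
    ofReal_integral_meanExpDiff_mul_len_mul_len lam ν₁ hν₂,
    ← lintegral_map_sum_sq_mul lam measurable_len.ennreal_ofReal (measurable_density lam ν₁ ν₂)]
  simp_rw [ENNReal.ofReal_pow (totalLength_nonneg _), ofReal_totalLength]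

variable [NullSingletonClass lam]

omit [IsFiniteMeasure lam] in
-- The two indicators differ only at `t = s`, a null set.
theorem lintegral_meetNe_mul (s : Seg B b) (k : Seg B b → ℝ≥0∞) :
    ∫⁻ t, ENNReal.ofReal (meetNe s t) * k t ∂lam = ∫⁻ t, ENNReal.ofReal (meet s t) * k t ∂lam :=
  lintegral_mul_congr_off_diag lam (g := fun s t => ENNReal.ofReal (meetNe s t))
    (m := fun s t => ENNReal.ofReal (meet s t)) (fun s t h => by rw [meetNe_of_ne h]) s k

theorem lintegral_numIntersections (hν₂ : ν₂ ≤ 0) :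
    ∫⁻ x, ENNReal.ofReal (numIntersections x) ∂(gibbsLaw lam ν₁ ν₂) =
      ENNReal.ofReal ((1 / 2) * ∫ y : Fin 2 → Seg B b,
        meanExpDiff lam ν₁ ν₂ y * meet (y 0) (y 1) ∂(Measure.pi fun _ => lam)) := by
  have hg : Measurable (uncurry fun s t : Seg B b => ENNReal.ofReal (meetNe s t)) :=
    measurable_meetNe.ennreal_ofReal
  rw [lintegral_gibbsLaw lam ν₁ ν₂ measurable_numIntersections.ennreal_ofReal,
    ENNReal.ofReal_mul (by norm_num), ofReal_integral_meanExpDiff_mul_meet lam ν₁ hν₂]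
  simp_rw [ofReal_numIntersections, mul_assoc]
  rw [lintegral_const_mul' _ _ ENNReal.ofReal_ne_top]
  have h := lintegral_pairSum_mul_correlation lam hg (fun s => by rw [meetNe_self]; simp)
    (measurable_density lam ν₁ ν₂) 0
  simp only [zero_add, lintegral_meetNe_mul] at h
  rw [h]
  rfl

theorem lintegral_numIntersections_sq (hν₂ : ν₂ ≤ 0) :
    ∫⁻ x, ENNReal.ofReal (numIntersections x ^ 2) ∂(gibbsLaw lam ν₁ ν₂) =
      ENNReal.ofReal ((1 / 2) * (∫ y : Fin 2 → Seg B b,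
          meanExpDiff lam ν₁ ν₂ y * meet (y 0) (y 1) ∂(Measure.pi fun _ => lam)) +
        (∫ y : Fin 3 → Seg B b,
          meanExpDiff lam ν₁ ν₂ y * meet (y 0) (y 1) * meet (y 2) (y 0)
            ∂(Measure.pi fun _ => lam)) +
        (1 / 4) * ∫ y : Fin 4 → Seg B b,
          meanExpDiff lam ν₁ ν₂ y * meet (y 0) (y 1) * meet (y 2) (y 3)
            ∂(Measure.pi fun _ => lam)) := by
  have hg : Measurable (uncurry fun s t : Seg B b => ENNReal.ofReal (meetNe s t)) :=
    measurable_meetNe.ennreal_ofReal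
  have h2 : 0 ≤ ∫ y : Fin 2 → Seg B b,
      meanExpDiff lam ν₁ ν₂ y * meet (y 0) (y 1) ∂(Measure.pi fun _ => lam) :=
    integral_nonneg fun y => mul_nonneg (meanExpDiff_nonneg lam ν₁ ν₂ _) (meet_nonneg _ _)
  have h34 {m : ℕ} (i j k l : Fin m) : 0 ≤ ∫ y : Fin m → Seg B b,
      meanExpDiff lam ν₁ ν₂ y * meet (y i) (y j) * meet (y k) (y l) ∂(Measure.pi fun _ => lam) :=
    integral_nonneg fun y => mul_nonneg (mul_nonneg (meanExpDiff_nonneg lam ν₁ ν₂ _)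
      (meet_nonneg _ _)) (meet_nonneg _ _)
  have h := lintegral_pairSum_sq_mul lam hg (fun s t => by rw [meetNe_comm])
    (fun s => by rw [meetNe_self]; simp)
    (fun s t => by rw [← ENNReal.ofReal_mul (meetNe_nonneg s t), meetNe_mul_self])
    (measurable_density lam ν₁ ν₂)
  simp only [lintegral_meetNe_mul] at h
  rw [← ofReal_integral_meanExpDiff_mul_meet lam ν₁ hν₂,
    ← ofReal_integral_meanExpDiff_mul_meet_three lam ν₁ hν₂,
    ← ofReal_integral_meanExpDiff_mul_meet_four lam ν₁ hν₂] at h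
  rw [lintegral_gibbsLaw lam ν₁ ν₂ (measurable_numIntersections.pow_const 2).ennreal_ofReal]
  have e (x : Multiset (Seg B b)) :
      ENNReal.ofReal (numIntersections x ^ 2) * density lam ν₁ ν₂ x =
        ENNReal.ofReal (1 / 2) ^ 2 * (pairSum (fun s t => ENNReal.ofReal (meetNe s t)) x ^ 2 *
          density lam ν₁ ν₂ x) := by
    rw [ENNReal.ofReal_pow (numIntersections_nonneg _), ofReal_numIntersections, mul_pow, mul_assoc]
  simp_rw [e]
  rw [lintegral_const_mul' _ _ (ENNReal.pow_ne_top ENNReal.ofReal_ne_top), h,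
    ofReal_half_sq_mul h2 (h34 _ _ _ _) (h34 _ _ _ _)]

end Gibbs

/-! ### From identities in `ℝ≥0∞` to real expectations. -/

section RealMoments

variable {α : Type*} [MeasurableSpace α] {P : Measure α} {f : α → ℝ}

theorem integral_eq_of_lintegral_ofReal_eq (hf : Measurable f) (h0 : ∀ x, 0 ≤ f x) {r : ℝ}
    (hr : 0 ≤ r) (h : ∫⁻ x, ENNReal.ofReal (f x) ∂P = ENNReal.ofReal r) : ∫ x, f x ∂P = r := by
  rw [integral_eq_lintegral_of_nonneg_ae (ae_of_all _ h0) hf.aestronglyMeasurable, h,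
    ENNReal.toReal_ofReal hr]

/-- Only the finiteness of the right-hand side matters, so a second-moment identity yields square
integrability at once. -/
theorem memLp_two_of_lintegral_ofReal_sq_eq (hf : Measurable f) {r : ℝ}
    (h : ∫⁻ x, ENNReal.ofReal (f x ^ 2) ∂P = ENNReal.ofReal r) : MemLp f 2 P := by
  rw [memLp_two_iff_integrable_sq hf.aestronglyMeasurable]
  refine ⟨(hf.pow_const 2).aestronglyMeasurable, ?_⟩
  rw [hasFiniteIntegral_iff_ofReal (ae_of_all _ fun x => sq_nonneg _), h]
  exact ENNReal.ofReal_lt_top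

end RealMoments

end SegmentGibbs

end

/-! ### The moment formulas. -/

theorem corollary2
    (B : Set Plane) (hB : MeasurableSet B) (hBbdd : Bornology.IsBounded B)
    (hBpos : 0 < volume B)
    (b : ℝ) (hb : 0 < b)
    (ρ : B → NNReal) (hρ : Measurable ρ) (hρbdd : ∃ M : NNReal, ∀ z, ρ z ≤ M)
    (Q : Measure (Set.Ioc (0 : ℝ) b)) (hQ : IsProbabilityMeasure Q)
    (V : Measure (Set.Ico (0 : ℝ) Real.pi)) (hV : IsProbabilityMeasure V)
    (lam : Measure (Seg B b)) (hlam : lam = intensity ρ Q V)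
    (ν₁ ν₂ : ℝ) (hν₂ : ν₂ ≤ 0) :
    -- the density is a well-defined probability density
    (Integrable (weight ν₁ ν₂) (poissonLaw lam) ∧
      0 < normConst lam ν₁ ν₂ ∧ IsProbabilityMeasure (gibbsLaw lam ν₁ ν₂)) ∧
    -- all the expectations and integrals below exist and are finite
    (MemLp totalLength 2 (gibbsLaw lam ν₁ ν₂) ∧ MemLp numIntersections 2 (gibbsLaw lam ν₁ ν₂) ∧
      (∀ (m : ℕ) (y : Fin m → Seg B b),
        Integrable (expDiff ν₁ ν₂ y) (gibbsLaw lam ν₁ ν₂)) ∧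
      Integrable (fun y => meanExpDiff lam ν₁ ν₂ ![y] * len y) lam ∧
      Integrable (fun y => meanExpDiff lam ν₁ ν₂ ![y] * len y ^ 2) lam ∧
      Integrable (fun y : Fin 2 → Seg B b =>
        meanExpDiff lam ν₁ ν₂ y * len (y 0) * len (y 1)) (Measure.pi fun _ => lam) ∧
      Integrable (fun y : Fin 2 → Seg B b =>
        meanExpDiff lam ν₁ ν₂ y * meet (y 0) (y 1)) (Measure.pi fun _ => lam) ∧
      Integrable (fun y : Fin 3 → Seg B b =>
        meanExpDiff lam ν₁ ν₂ y * meet (y 0) (y 1) * meet (y 2) (y 0))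
        (Measure.pi fun _ => lam) ∧
      Integrable (fun y : Fin 4 → Seg B b =>
        meanExpDiff lam ν₁ ν₂ y * meet (y 0) (y 1) * meet (y 2) (y 3))
        (Measure.pi fun _ => lam)) ∧
    -- the mean of the total length
    ∫ x, totalLength x ∂(gibbsLaw lam ν₁ ν₂) = ∫ y, meanExpDiff lam ν₁ ν₂ ![y] * len y ∂lam ∧
    -- the mean of the number of intersections
    ∫ x, numIntersections x ∂(gibbsLaw lam ν₁ ν₂) =
      (1 / 2) * ∫ y : Fin 2 → Seg B b,
        meanExpDiff lam ν₁ ν₂ y * meet (y 0) (y 1) ∂(Measure.pi fun _ => lam) ∧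
    -- the second moment of the total length
    ∫ x, totalLength x ^ 2 ∂(gibbsLaw lam ν₁ ν₂) =
      (∫ y, meanExpDiff lam ν₁ ν₂ ![y] * len y ^ 2 ∂lam) +
      (∫ y : Fin 2 → Seg B b,
        meanExpDiff lam ν₁ ν₂ y * len (y 0) * len (y 1) ∂(Measure.pi fun _ => lam)) ∧
    -- the second moment of the number of intersections
    ∫ x, numIntersections x ^ 2 ∂(gibbsLaw lam ν₁ ν₂) =
      (1 / 2) * (∫ y : Fin 2 → Seg B b,
        meanExpDiff lam ν₁ ν₂ y * meet (y 0) (y 1) ∂(Measure.pi fun _ => lam)) +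
      (∫ y : Fin 3 → Seg B b,
        meanExpDiff lam ν₁ ν₂ y * meet (y 0) (y 1) * meet (y 2) (y 0)
          ∂(Measure.pi fun _ => lam)) +
      (1 / 4) * ∫ y : Fin 4 → Seg B b,
        meanExpDiff lam ν₁ ν₂ y * meet (y 0) (y 1) * meet (y 2) (y 3)
          ∂(Measure.pi fun _ => lam) := by
  subst hlam
  have := isFiniteMeasure_intensity hB hBbdd ρ hρbdd Q V
  have := nullSingletonClass_intensity ρ Q V hB
  set lam := intensity ρ Q V
  have n1 (y : Seg B b) : 0 ≤ meanExpDiff lam ν₁ ν₂ ![y] * len y :=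
    mul_nonneg (meanExpDiff_nonneg lam ν₁ ν₂ _) (len_nonneg y)
  have n1' (y : Seg B b) : 0 ≤ meanExpDiff lam ν₁ ν₂ ![y] * len y ^ 2 :=
    mul_nonneg (meanExpDiff_nonneg lam ν₁ ν₂ _) (sq_nonneg _)
  have n2 (y : Fin 2 → Seg B b) : 0 ≤ meanExpDiff lam ν₁ ν₂ y * len (y 0) * len (y 1) :=
    mul_nonneg (mul_nonneg (meanExpDiff_nonneg lam ν₁ ν₂ _) (len_nonneg _)) (len_nonneg _)
  have n2' (y : Fin 2 → Seg B b) : 0 ≤ meanExpDiff lam ν₁ ν₂ y * meet (y 0) (y 1) :=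
    mul_nonneg (meanExpDiff_nonneg lam ν₁ ν₂ _) (meet_nonneg _ _)
  have n34 {m : ℕ} (i j k l : Fin m) (y : Fin m → Seg B b) :
      0 ≤ meanExpDiff lam ν₁ ν₂ y * meet (y i) (y j) * meet (y k) (y l) :=
    mul_nonneg (mul_nonneg (meanExpDiff_nonneg lam ν₁ ν₂ _) (meet_nonneg _ _)) (meet_nonneg _ _)
  have hL := measurable_totalLength (B := B) (b := b)
  have hN := measurable_numIntersections (B := B) (b := b)
  refine ⟨⟨integrable_weight lam ν₁ hν₂, normConst_pos lam ν₁ hν₂,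
      isProbabilityMeasure_gibbsLaw lam ν₁ hν₂⟩,
    ⟨memLp_two_of_lintegral_ofReal_sq_eq hL (lintegral_totalLength_sq lam ν₁ hν₂),
      memLp_two_of_lintegral_ofReal_sq_eq hN (lintegral_numIntersections_sq lam ν₁ hν₂),
      fun m y => integrable_expDiff lam ν₁ hν₂ y,
      integrable_meanExpDiff_mul_len lam ν₁ hν₂,
      integrable_meanExpDiff_mul_len_sq lam ν₁ hν₂,
      integrable_meanExpDiff_mul_len_mul_len lam ν₁ hν₂,
      integrable_meanExpDiff_mul_meet lam ν₁ hν₂,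
      integrable_meanExpDiff_mul_meet_mul_meet lam ν₁ hν₂ 0 1 2 0,
      integrable_meanExpDiff_mul_meet_mul_meet lam ν₁ hν₂ 0 1 2 3⟩, ?_, ?_, ?_, ?_⟩
  · exact integral_eq_of_lintegral_ofReal_eq hL totalLength_nonneg (integral_nonneg n1)
      (lintegral_totalLength lam ν₁ hν₂)
  · exact integral_eq_of_lintegral_ofReal_eq hN numIntersections_nonneg
      (mul_nonneg (by norm_num) (integral_nonneg n2')) (lintegral_numIntersections lam ν₁ hν₂)
  · exact integral_eq_of_lintegral_ofReal_eq (hL.pow_const 2) (fun x => sq_nonneg _)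
      (add_nonneg (integral_nonneg n1') (integral_nonneg n2))
      (lintegral_totalLength_sq lam ν₁ hν₂)
  · exact integral_eq_of_lintegral_ofReal_eq (hN.pow_const 2) (fun x => sq_nonneg _)
      (add_nonneg (add_nonneg (mul_nonneg (by norm_num) (integral_nonneg n2'))
        (integral_nonneg (n34 0 1 2 0))) (mul_nonneg (by norm_num) (integral_nonneg (n34 0 1 2 3))))
      (lintegral_numIntersections_sq lam ν₁ hν₂)
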